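/- A discrete quantum group $H$ is a multiplier Hopf $*$-algebra whose underlying $*$-algebra is an algebraic direct sum $\bigoplus_{s\in I}M_{d(s)}(\mathbb C)$ of full matrix algebras. Write $\mathcal F(H)=\prod_{s\in I}M_{d(s)}(\mathbb C)$ for the algebra of all functions on $H$, $\ell^\infty(H)\subset\mathcal F(H)$ for the von Neumann algebra of bounded ones, and $\Delta_H$ for the comultiplication, extended to $\mathcal F(H)$. Let $G$ be a finite normal quantum subgroup of $H$. That is, $G$ is a finite quantum group together with a surjective normal $*$-homomorphism $\pi\colon\ell^\infty(H)\to\ell^\infty(G)$ (which extends to $\mathcal F(H)$) respecting the coproducts, such that for $x\in\ell^\infty(H)$ the condition $(\pi\otimes\iota)\Delta_H(x)=1\otimes x$ of left $G$-invariance is equivalent to the condition $(\iota\otimes\pi)\Delta_H(x)=x\otimes1$ of right $G$-invariance. The two conditions also make sense for $x\in\mathcal F(H)$, and $x$ is called $G$-invariant if it satisfies both. Let $H/G$ be the quotient: $\ell^\infty(H/G)\subset\ell^\infty(H)$ is the algebra of bounded $G$-invariant functions, with the restriction of $\Delta_H$ as comultiplication. Let $\phi$ be a normal state on $\ell^\infty(H)$,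 with restrictions $\phi_s$ to the blocks. Put $P_\phi=(\phi\otimes\iota)\Delta_H$, and let $\phi^1=\phi$, $\phi^{n+1}=(\phi^n\otimes\phi)\Delta_H$ be the convolution powers. Assume that $\phi$ is generating: $\bigvee_{n\ge1}\operatorname{supp}\phi^n=1$. A positive, possibly unbounded, element $x\in\mathcal F(H)$ is called $P_\phi$-harmonic if $\sum_{s\in I}(\phi_s\otimes\iota)(\Delta_H(x)_{s,t})=x_t$ for all $t\in I$. The Poisson boundary of $(H,\phi)$ is the space $H^\infty(H;\phi)=\{x\in\ell^\infty(H): P_\phi(x)=x\}$ with the product $x\cdot y=s^*\text{-}\lim_{n\to\infty}P_\phi^n(xy)$; similarly for $H/G$ and normal states on $\ell^\infty(H/G)$. Then every positive, possibly unbounded, $P_\phi$-harmonic $x\in\mathcal F(H)$ is $G$-invariant. Moreover, with $\bar\phi=\phi|_{\ell^\infty(H/G)}$, $$H^\infty(H;\phi)=H^\infty(H/G;\bar\phi)$$ as subspaces of $\ell^\infty(H)$, and the products of the two Poisson boundaries coincide. -/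

import Mathlib

open scoped ComplexOrder
open Filter Topology

universe u v

/-- The algebra `∏ₛ M_{d(s)}(ℂ)` of all functions, bounded or not. -/
abbrev BlockFun {I : Type u} (d : I → ℕ) : Type u :=
  ∀ s, Matrix (Fin (d s)) (Fin (d s)) ℂ

/-- The algebra `∏_{s,t} M_{d(s)}(ℂ) ⊗ M_{e(t)}(ℂ)` of all functions of two variables, with
`M_m(ℂ) ⊗ M_n(ℂ)` realised as matrices indexed by pairs (Kronecker product). -/
abbrev BlockFun₂ {I : Type u} {J : Type v} (d : I → ℕ) (e : J → ℕ) : Type max u v :=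
  ∀ s t, Matrix (Fin (d s) × Fin (e t)) (Fin (d s) × Fin (e t)) ℂ

section Slices

variable {I : Type u} {J : Type v} {d : I → ℕ} {e : J → ℕ}

/-- The coefficient in the first leg of the matrix unit `E_{jl}` of the block `t` of the
second leg: `y_{s,t} = ∑_{j,l} (sliceL y t j l)_s ⊗ E_{jl}`. -/
def sliceL (y : BlockFun₂ d e) (t : J) (j l : Fin (e t)) : BlockFun d :=
  fun s => Matrix.of fun i k => y s t (i, j) (k, l)

/-- The coefficient in the second leg of the matrix unit `E_{ik}` of the block `s` of the
first leg: `y_{s,t} = ∑_{i,k} E_{ik} ⊗ (sliceR y s i k)_t`. -/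
def sliceR (y : BlockFun₂ d e) (s : I) (i k : Fin (d s)) : BlockFun e :=
  fun t => Matrix.of fun j l => y s t (i, j) (k, l)

/-- `f` only depends on finitely many blocks. A *-homomorphism from the bounded functions to a
finite dimensional algebra is normal iff it is of this kind, and such a map is defined on all
functions. -/
def FactorsThroughFinite {X : Type*} [Zero X] (f : BlockFun d → X) : Prop :=
  ∃ T : Finset I, ∀ x, (∀ s ∈ T, x s = 0) → f x = 0

/-- `(ω ⊗ ι)(y)`. -/
def applyLeft (ω : BlockFun d → ℂ) (y : BlockFun₂ d e) : BlockFun e :=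
  fun t => Matrix.of fun j l => ω (sliceL y t j l)

end Slices

/-- A discrete quantum group `H`: a multiplier Hopf *-algebra whose underlying *-algebra
`c_c(H)` is an algebraic direct sum of full matrix algebras. The algebra of multipliers of
`c_c(H)` is the algebra `BlockFun dim` of all functions on `H`, and the comultiplication is
given here in its canonical extension to multipliers. -/
structure DiscreteQuantumGroup where
  /-- The set of blocks. -/
  Idx : Type u
  /-- The sizes of the blocks. -/
  dim : Idx → ℕ
  dim_pos : ∀ s, 0 < dim s
  /-- The comultiplication. -/
  comul : BlockFun dim →⋆ₐ[ℂ] BlockFun₂ dim dim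
  comul_finite : ∀ s t, FactorsThroughFinite fun x => comul x s t
  /-- `Δ(a)(1 ⊗ b)` is finitely supported for finitely supported `a` and `b`. -/
  comul_finite_left : ∀ a : BlockFun dim, {r | a r ≠ 0}.Finite →
    ∀ t, {s | comul a s t ≠ 0}.Finite
  /-- `(b ⊗ 1)Δ(a)` is finitely supported for finitely supported `a` and `b`. -/
  comul_finite_right : ∀ a : BlockFun dim, {r | a r ≠ 0}.Finite →
    ∀ s, {t | comul a s t ≠ 0}.Finite
  /-- `(Δ ⊗ ι)Δ = (ι ⊗ Δ)Δ`, entry by entry. -/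
  coassoc : ∀ (x : BlockFun dim) (r s t : Idx) (i i' : Fin (dim r)) (j j' : Fin (dim s))
    (k k' : Fin (dim t)),
    comul (sliceL (comul x) t k k') r s (i, j) (i', j') =
      comul (sliceR (comul x) r i i') s t (j, k) (j', k')
  /-- The counit. -/
  counit : BlockFun dim →⋆ₐ[ℂ] ℂ
  counit_finite : FactorsThroughFinite counit
  /-- `(ε ⊗ ι)Δ = ι`. -/
  counit_left : ∀ (x : BlockFun dim) (t : Idx) (j l : Fin (dim t)),
    counit (sliceL (comul x) t j l) = x t j l
  /-- `(ι ⊗ ε)Δ = ι`. -/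
  counit_right : ∀ (x : BlockFun dim) (s : Idx) (i k : Fin (dim s)),
    counit (sliceR (comul x) s i k) = x s i k
  /-- The involution on the set of blocks defined by the antipode. -/
  conj : Idx → Idx
  conj_involutive : Function.Involutive conj
  /-- The antipode, mapping the block `s` to the block `conj s`. -/
  antipode : ∀ s, Matrix (Fin (dim s)) (Fin (dim s)) ℂ →ₗ[ℂ]
    Matrix (Fin (dim (conj s))) (Fin (dim (conj s))) ℂ
  /-- `m(S ⊗ ι)Δ = ε(·)1`, in the block `conj s`. -/
  antipode_left : ∀ (x : BlockFun dim) (s : Idx),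
    ∑ i, ∑ k, antipode s (Matrix.single i k 1) * sliceR (comul x) s i k (conj s) =
      counit x • (1 : Matrix (Fin (dim (conj s))) (Fin (dim (conj s))) ℂ)
  /-- `m(ι ⊗ S)Δ = ε(·)1`, in the block `conj s`. -/
  antipode_right : ∀ (x : BlockFun dim) (s : Idx),
    ∑ j, ∑ l, sliceL (comul x) s j l (conj s) * antipode s (Matrix.single j l 1) =
      counit x • (1 : Matrix (Fin (dim (conj s))) (Fin (dim (conj s))) ℂ)

namespace DiscreteQuantumGroup

/-- The algebra of all functions on `H`. -/
abbrev Fun (H : DiscreteQuantumGroup.{u}) : Type u := BlockFun H.dim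

/-- The bounded functions (operator norm in each block): `ℓ^∞(H)`. -/
def linf (H : DiscreteQuantumGroup.{u}) : Set H.Fun :=
  open scoped Matrix.Norms.L2Operator in {x | ∃ C : ℝ, ∀ s, ‖x s‖ ≤ C}

/-- A function is positive if it is so in each block. -/
def IsPositive {H : DiscreteQuantumGroup.{u}} (x : H.Fun) : Prop := ∀ s, (x s).PosSemidef

/-- A normal state on `ℓ^∞(H)`. The predual of the `ℓ^∞`-direct sum of the blocks is the
`ℓ¹`-direct sum of the duals of the blocks, so this is a family of positive functionals on
the blocks with total mass one. -/
structure NormalState (H : DiscreteQuantumGroup.{u}) where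
  /-- The restriction to the block `s`. -/
  block : ∀ s, Matrix (Fin (H.dim s)) (Fin (H.dim s)) ℂ →ₗ[ℂ] ℂ
  nonneg : ∀ s a, a.PosSemidef → 0 ≤ block s a
  hasSum_one : HasSum (fun s => block s 1) 1

/-- The value `φ(x)`; the series converges absolutely for bounded `x`. -/
noncomputable def NormalState.eval {H : DiscreteQuantumGroup.{u}} (φ : H.NormalState)
    (x : H.Fun) : ℂ := ∑' s, φ.block s (x s)

/-- The restriction of `φ` to a subset of `ℓ^∞(H)`. -/
noncomputable def NormalState.restrict {H : DiscreteQuantumGroup.{u}} (φ : H.NormalState)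
    (A : Set H.Fun) : A → ℂ := fun x => φ.eval x

/-- The convolution powers: `φ^0 = ε` and `φ^{n+1} = (φ^n ⊗ φ)Δ`. -/
noncomputable def NormalState.convPow {H : DiscreteQuantumGroup.{u}} (φ : H.NormalState) :
    ℕ → H.Fun → ℂ
  | 0, x => H.counit x
  | n + 1, x => φ.eval (applyLeft (φ.convPow n) (H.comul x))

/-- `p` is the support of the normal state `ω`: the smallest projection with `ω(p) = 1`
(recall that `p ≤ q` means `p * q = p` for projections). -/
def IsSupport {H : DiscreteQuantumGroup.{u}} (ω : H.Fun → ℂ) (p : H.Fun) : Prop :=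
  IsStarProjection p ∧ ω p = 1 ∧ ∀ q : H.Fun, IsStarProjection q → ω q = 1 → p * q = p

/-- `φ` is generating: `⋁_{n ≥ 1} supp φ^n = 1`, that is, the only projection which is an
upper bound of the supports is `1`. -/
def NormalState.IsGenerating {H : DiscreteQuantumGroup.{u}} (φ : H.NormalState) : Prop :=
  ∀ r : H.Fun, IsStarProjection r →
    (∀ n : ℕ, 1 ≤ n → ∀ p : H.Fun, IsSupport (φ.convPow n) p → p * r = p) → r = 1

/-- `P_φ(x) = x` for a possibly unbounded function `x`, where `P_φ(x)` in the block `t` is the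
sum of the series `∑ₛ (φₛ ⊗ ι)(Δ(x)_{s,t})`. -/
def NormalState.IsHarmonic {H : DiscreteQuantumGroup.{u}} (φ : H.NormalState)
    (x : H.Fun) : Prop :=
  ∀ (t : H.Idx) (j l : Fin (H.dim t)),
    HasSum (fun s => φ.block s (sliceL (H.comul x) t j l s)) (x t j l)

/-- `G` as a quantum subgroup of `H`: a surjective normal *-homomorphism
`π : ℓ^∞(H) → ℓ^∞(G)` respecting the coproducts, in its extension to all functions. -/
structure QuantumSubgroup (G : DiscreteQuantumGroup.{v}) (H : DiscreteQuantumGroup.{u}) where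
  /-- The restriction map. -/
  π : H.Fun →⋆ₐ[ℂ] G.Fun
  surjective : Function.Surjective π
  normal : ∀ t, FactorsThroughFinite fun x => π x t
  /-- `Δ_G π = (π ⊗ π)Δ_H`, entry by entry. -/
  map_comul : ∀ (x : H.Fun) (s t : G.Idx) (i k : Fin (G.dim s)) (j l : Fin (G.dim t)),
    G.comul (π x) s t (i, j) (k, l) =
      π (fun a => Matrix.of fun b c => π (sliceR (H.comul x) a b c) t j l) s i k

namespace QuantumSubgroup

variable {G : DiscreteQuantumGroup.{v}} {H : DiscreteQuantumGroup.{u}}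

/-- `(π ⊗ ι)Δ(x) = 1 ⊗ x`. -/
def IsLeftInvariant (N : QuantumSubgroup G H) (x : H.Fun) : Prop :=
  ∀ (t : H.Idx) (j l : Fin (H.dim t)), N.π (sliceL (H.comul x) t j l) = x t j l • (1 : G.Fun)

/-- `(ι ⊗ π)Δ(x) = x ⊗ 1`. -/
def IsRightInvariant (N : QuantumSubgroup G H) (x : H.Fun) : Prop :=
  ∀ (s : H.Idx) (i k : Fin (H.dim s)), N.π (sliceR (H.comul x) s i k) = x s i k • (1 : G.Fun)

/-- `ℓ^∞(G\H) = ℓ^∞(H/G)`. -/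
def IsNormal (N : QuantumSubgroup G H) : Prop :=
  ∀ x ∈ H.linf, N.IsLeftInvariant x ↔ N.IsRightInvariant x

/-- `ℓ^∞(H/G)`, the fixed points of the right action of `G` in `ℓ^∞(H)`. -/
def quotientLinf (N : QuantumSubgroup G H) : Set H.Fun :=
  {x | x ∈ H.linf ∧ N.IsRightInvariant x}

end QuantumSubgroup

/-- `(ω ⊗ ι)Δ(x) = y` for a functional `ω` on a subalgebra `A` of `ℓ^∞(H)`, the first leg of
`Δ(x)` being in `A`. With `A = ℓ^∞(H)` this is the convolution operator of `H`, with
`A = ℓ^∞(H/G)` that of `H/G`, whose coproduct is the restriction of that of `H`. -/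
def IsConvolution {H : DiscreteQuantumGroup.{u}} (A : Set H.Fun) (ω : A → ℂ)
    (x y : H.Fun) : Prop :=
  ∀ (t : H.Idx) (j l : Fin (H.dim t)),
    ∃ h : sliceL (H.comul x) t j l ∈ A, ω ⟨_, h⟩ = y t j l

/-- The underlying space of the Poisson boundary: the harmonic elements of `A`. -/
def poissonBoundary {H : DiscreteQuantumGroup.{u}} (A : Set H.Fun) (ω : A → ℂ) : Set H.Fun :=
  {x | x ∈ A ∧ IsConvolution A ω x x}

/-- Convergence of a sequence of bounded functions in the strong* topology: it is uniformly
bounded and converges in each block. -/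
def StrongStarTendsto {H : DiscreteQuantumGroup.{u}} (y : ℕ → H.Fun) (z : H.Fun) : Prop :=
  open scoped Matrix.Norms.L2Operator in
  (∃ C : ℝ, ∀ n s, ‖y n s‖ ≤ C) ∧ ∀ s, Tendsto (fun n => y n s) atTop (𝓝 (z s))

/-- `z` is the product of `x` and `y` in the Poisson boundary: the strong* limit of the
sequence `P_ω^n(x y)`. -/
def IsPoissonProduct {H : DiscreteQuantumGroup.{u}} (A : Set H.Fun) (ω : A → ℂ)
    (x y z : H.Fun) : Prop :=
  ∃ w : ℕ → H.Fun, w 0 = x * y ∧ (∀ n, w n ∈ A) ∧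
    (∀ n, IsConvolution A ω (w n) (w (n + 1))) ∧ StrongStarTendsto w z

end DiscreteQuantumGroup

/-! ### Functionals of finitely many blocks, and Fubini for them -/

section LocalFunctionals

variable {I : Type u} {J : Type v} {d : I → ℕ} {e : J → ℕ}

/-! Let `ω` be the Haar state of `G`, `θ = ω ∘ π` and `E = (θ ⊗ ι)Δ`. Left invariance of `x` means
`E x = x`, right invariance means `(ι ⊗ θ)Δ(x) = x`, and normality makes the two averages equal
(`convL_pull_eq_convR_pull`). As a right convolution, `E` commutes with `P_φ`, which convolves on
the left. As `θ` sees only finitely many blocks, all this makes sense for unbounded functions, and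
`E` preserves positive harmonic ones. It remains to see that `E` fixes them.

The generating hypothesis enters through a Harnack inequality. If `0 ≤ a ≤ z` with `a` finitely
supported and `z` harmonic, then `φ^n(a) ≤ ε(z)` (`exists_convPow_eq`). On a given block the `φ^n`
annihilate no common rank one projection, so by compactness finitely many of them dominate any
positive functional there (`Matrix.exists_le_sum`). Hence `θ(z) ≤ C ε(z)` with `C` independent of
the positive harmonic `z` (`exists_apply_le`). Right translates of `z` are again harmonic, and
testing on them turns this into the operator inequality `E z ≤ C z`.

Applying that inequality to `z = x - a • E x ≥ 0` improves the coefficient `a`, and in the limit `x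
≥ E x`. Since `E (x - E x) = 0`, faithfulness of `E` on positive functions gives `x = E x`
(`convL_eq_self`). Faithfulness comes from that of `ω` and from `ε_G ∘ π = ε_H` (`counit_π`).

Bounded harmonic functions are combinations of positive ones and `1`, so they are invariant too.
Products of invariant functions and their images under `P_φ` remain invariant, so the sequences
defining the two Poisson products are the same.

The Haar state is the normalised trace of the regular representation (`exists_haar`): `Δ(x)` is
conjugate to `x ⊗ 1` by the Galois map, so this trace `h` satisfies `h * h = h(1) h`, and an
equality case of Cauchy–Schwarz upgrades this to invariance. -/

/-- `(ι ⊗ ω)(y)`. -/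
def applyRight (ω : BlockFun e → ℂ) (y : BlockFun₂ d e) : BlockFun d :=
  fun s => Matrix.of fun i k => ω (sliceR y s i k)

/-- The coordinate functional `x ↦ x t j l`. -/
def coordFun (t : I) (j l : Fin (d t)) : BlockFun d →ₗ[ℂ] ℂ where
  toFun x := x t j l
  map_add' _ _ := rfl
  map_smul' _ _ := rfl

theorem coordFun_apply (t : I) (j l : Fin (d t)) (x : BlockFun d) :
    coordFun t j l x = x t j l := rfl

theorem coordFun_finite (t : I) (j l : Fin (d t)) :
    FactorsThroughFinite (coordFun (d := d) t j l) :=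
  ⟨{t}, fun x hx => by simp [coordFun_apply, hx t]⟩

theorem FactorsThroughFinite.exists_eq_sum_single [DecidableEq I] {M : Type*} [AddCommGroup M]
    [Module ℂ M] {f : BlockFun d →ₗ[ℂ] M} (hf : FactorsThroughFinite f) :
    ∃ T : Finset I, ∀ x, f x = ∑ s ∈ T, f (Pi.single s (x s)) := by
  obtain ⟨T, hT⟩ := hf
  refine ⟨T, fun x => ?_⟩
  rw [← map_sum, ← sub_eq_zero, ← map_sub]
  apply hT
  intro s hs
  rw [Pi.sub_apply, Finset.sum_apply, Finset.sum_eq_single s]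
  · simp
  · exact fun b _ hb => Pi.single_eq_of_ne hb.symm _
  · exact fun h => absurd hs h

/-- A functional depending on finitely many blocks is a finite combination of coordinates. -/
theorem FactorsThroughFinite.exists_eq_sum {f : BlockFun d →ₗ[ℂ] ℂ}
    (hf : FactorsThroughFinite f) :
    ∃ (T : Finset I) (c : BlockFun d), ∀ x, f x = ∑ s ∈ T, ∑ i, ∑ k, c s i k * x s i k := by
  classical
  obtain ⟨T, hT⟩ := hf.exists_eq_sum_single
  refine ⟨T, fun s => Matrix.of fun i k => f (Pi.single s (Matrix.single i k 1)), fun x => ?_⟩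
  rw [hT x]
  refine Finset.sum_congr rfl fun s _ => ?_
  have h2 : ∀ a : Matrix (Fin (d s)) (Fin (d s)) ℂ,
      f (Pi.single s a) = (f ∘ₗ LinearMap.single ℂ _ s) a := fun a => rfl
  conv_lhs => rw [h2, Matrix.matrix_eq_sum_single (x s)]
  simp only [map_sum]
  refine Finset.sum_congr rfl fun i _ => Finset.sum_congr rfl fun k _ => ?_
  have h3 : Matrix.single i k (x s i k) = x s i k • Matrix.single i k (1 : ℂ) := by
    rw [Matrix.smul_single, smul_eq_mul, mul_one]
  rw [h3, map_smul, smul_eq_mul, mul_comm]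
  rfl

/-- Fubini for functionals one of which depends on finitely many blocks. -/
theorem apply_applyRight (f : BlockFun d →ₗ[ℂ] ℂ) {g : BlockFun e →ₗ[ℂ] ℂ}
    (hg : FactorsThroughFinite g) (y : BlockFun₂ d e) :
    f (applyRight g y) = g (applyLeft f y) := by
  obtain ⟨T, b, hg⟩ := hg.exists_eq_sum
  have h : applyRight g y = ∑ t ∈ T, ∑ j, ∑ l, b t j l • sliceL y t j l := by
    funext s
    ext i k
    simp only [applyRight, hg, Matrix.of_apply, sliceR, sliceL, Finset.sum_apply,
      Matrix.sum_apply, Pi.smul_apply, Matrix.smul_apply, smul_eq_mul]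
  simp only [h, map_sum, map_smul, hg, smul_eq_mul, applyLeft, Matrix.of_apply]

theorem FactorsThroughFinite.comp {X : Type*} [Zero X] {f : BlockFun e → X}
    (hf : FactorsThroughFinite f)
    {Φ : BlockFun d → BlockFun e} (hΦ : ∀ t, FactorsThroughFinite fun x => Φ x t) :
    FactorsThroughFinite fun x => f (Φ x) := by
  classical
  obtain ⟨T, hT⟩ := hf
  choose S hS using hΦ
  refine ⟨T.biUnion S, fun x hx => hT _ fun t ht => hS t x fun s hs => hx s ?_⟩
  exact Finset.mem_biUnion.2 ⟨t, ht, hs⟩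

/-- Two functionals depending on finitely many blocks are equal if they agree on functions
of finite support. -/
theorem FactorsThroughFinite.eq_of_finite_support {f g : BlockFun d →ₗ[ℂ] ℂ}
    (hf : FactorsThroughFinite f) (hg : FactorsThroughFinite g)
    (h : ∀ x, {s | x s ≠ 0}.Finite → f x = g x) (x : BlockFun d) : f x = g x := by
  classical
  obtain ⟨S, hS⟩ := hf
  obtain ⟨T, hT⟩ := hg
  let y : BlockFun d := fun s => if s ∈ S ∪ T then x s else 0
  have hy : {s | y s ≠ 0}.Finite := (S ∪ T).finite_toSet.subset fun s hs => by
    by_contra h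
    exact hs (if_neg h)
  have h1 : f (x - y) = 0 := hS _ fun s hs => by
    simp [y, hs]
  have h2 : g (x - y) = 0 := hT _ fun s hs => by
    simp [y, hs]
  rw [map_sub, sub_eq_zero] at h1 h2
  rw [h1, h2, h y hy]

end LocalFunctionals

namespace DiscreteQuantumGroup

/-! ### Left and right convolution operators -/

section Convolution

variable {H : DiscreteQuantumGroup.{u}}

/-- `Δ(x)_{s,t}` as a functional of `x`, one matrix entry at a time. -/
def comulEntry (H : DiscreteQuantumGroup.{u}) (s t : H.Idx) (p q : Fin (H.dim s) × Fin (H.dim t)) :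
    H.Fun →ₗ[ℂ] ℂ where
  toFun x := H.comul x s t p q
  map_add' x y := by rw [map_add]; rfl
  map_smul' c x := by rw [map_smul]; rfl

theorem comulEntry_finite (s t : H.Idx) (p q : Fin (H.dim s) × Fin (H.dim t)) :
    FactorsThroughFinite (H.comulEntry s t p q) := by
  obtain ⟨T, hT⟩ := H.comul_finite s t
  exact ⟨T, fun x hx => congrFun (congrFun (hT x hx) p) q⟩

/-- `x ↦ (ω ⊗ ι)Δ(x)`. -/
def convL (f : H.Fun →ₗ[ℂ] ℂ) : H.Fun →ₗ[ℂ] H.Fun where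
  toFun x := applyLeft f (H.comul x)
  map_add' x y := by
    funext t; ext j l
    rw [map_add]
    exact map_add f (sliceL (H.comul x) t j l) (sliceL (H.comul y) t j l)
  map_smul' c x := by
    funext t; ext j l
    rw [map_smul]
    exact map_smul f c (sliceL (H.comul x) t j l)

/-- `x ↦ (ι ⊗ ω)Δ(x)`. -/
def convR (f : H.Fun →ₗ[ℂ] ℂ) : H.Fun →ₗ[ℂ] H.Fun where
  toFun x := applyRight f (H.comul x)
  map_add' x y := by
    funext t; ext j l
    rw [map_add]
    exact map_add f (sliceR (H.comul x) t j l) (sliceR (H.comul y) t j l)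
  map_smul' c x := by
    funext t; ext j l
    rw [map_smul]
    exact map_smul f c (sliceR (H.comul x) t j l)

theorem convL_apply (f : H.Fun →ₗ[ℂ] ℂ) (x : H.Fun) (t : H.Idx) (j l : Fin (H.dim t)) :
    convL f x t j l = f (sliceL (H.comul x) t j l) := rfl

theorem convR_apply (f : H.Fun →ₗ[ℂ] ℂ) (x : H.Fun) (s : H.Idx) (i k : Fin (H.dim s)) :
    convR f x s i k = f (sliceR (H.comul x) s i k) := rfl

theorem convR_coordFun (x : H.Fun) (t : H.Idx) (j l : Fin (H.dim t)) :
    convR (coordFun t j l) x = sliceL (H.comul x) t j l := rfl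

/-- `f((ι ⊗ g)Δ(x)) = g((f ⊗ ι)Δ(x))`. -/
theorem apply_convR (f : H.Fun →ₗ[ℂ] ℂ) {g : H.Fun →ₗ[ℂ] ℂ} (hg : FactorsThroughFinite g)
    (x : H.Fun) : f (convR g x) = g (convL f x) :=
  apply_applyRight f hg _

theorem sliceR_comul_convR {g : H.Fun →ₗ[ℂ] ℂ} (hg : FactorsThroughFinite g) (x : H.Fun)
    (s : H.Idx) (i k : Fin (H.dim s)) :
    sliceR (H.comul (convR g x)) s i k = convR g (sliceR (H.comul x) s i k) := by
  funext t; ext j l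
  change H.comulEntry s t (i, j) (k, l) (convR g x) = _
  rw [apply_convR _ hg, convR_apply]
  congr 1
  funext r; ext p q
  exact H.coassoc x s t r i k j l p q

theorem sliceL_comul_convL (f : H.Fun →ₗ[ℂ] ℂ) (x : H.Fun)
    (t : H.Idx) (j l : Fin (H.dim t)) :
    sliceL (H.comul (convL f x)) t j l = convL f (sliceL (H.comul x) t j l) := by
  funext s; ext i k
  change H.comulEntry s t (i, j) (k, l) (convL f x) = _
  rw [← apply_convR _ (comulEntry_finite _ _ _ _), convL_apply]
  congr 1
  funext r; ext p q
  exact (H.coassoc x r s t p q i k j l).symm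

theorem convR_finite {g : H.Fun →ₗ[ℂ] ℂ} (hg : FactorsThroughFinite g) (s : H.Idx) :
    FactorsThroughFinite fun x => convR g x s := by
  classical
  obtain ⟨T, hT⟩ := hg
  choose S hS using fun t => H.comul_finite s t
  refine ⟨T.biUnion S, fun x hx => ?_⟩
  ext i k
  refine hT _ fun t ht => ?_
  ext j l
  exact congrFun (congrFun (hS t x fun r hr => hx r (Finset.mem_biUnion.2 ⟨t, ht, hr⟩)) _) _

theorem convL_finite {f : H.Fun →ₗ[ℂ] ℂ} (hf : FactorsThroughFinite f) (t : H.Idx) :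
    FactorsThroughFinite fun x => convL f x t := by
  classical
  obtain ⟨T, hT⟩ := hf
  choose S hS using fun s => H.comul_finite s t
  refine ⟨T.biUnion S, fun x hx => ?_⟩
  ext i k
  refine hT _ fun s hs => ?_
  ext j l
  exact congrFun (congrFun (hS s x fun r hr => hx r (Finset.mem_biUnion.2 ⟨s, hs, hr⟩)) _) _

theorem convR_convR (f : H.Fun →ₗ[ℂ] ℂ) {g : H.Fun →ₗ[ℂ] ℂ} (hg : FactorsThroughFinite g) (x : H.Fun) :
    convR f (convR g x) = convR (f ∘ₗ convR g) x := by
  funext s; ext i k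
  rw [convR_apply, sliceR_comul_convR hg]
  rfl

theorem convL_convL (f g : H.Fun →ₗ[ℂ] ℂ) (x : H.Fun) :
    convL f (convL g x) = convL (f ∘ₗ convL g) x := by
  funext s; ext i k
  rw [convL_apply, sliceL_comul_convL]
  rfl

/-- Coassociativity, together with Fubini. Only the right functional has to be local, since only it
is moved past the other one. -/
theorem convL_convR_comm (f : H.Fun →ₗ[ℂ] ℂ) {g : H.Fun →ₗ[ℂ] ℂ}
    (hg : FactorsThroughFinite g) (x : H.Fun) :
    convL f (convR g x) = convR g (convL f x) := by
  funext t; ext j l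
  rw [convL_apply, convR_apply]
  have h : sliceL (H.comul (convR g x)) t j l =
      applyRight g fun s r => Matrix.of fun a b =>
        H.comul (sliceL (H.comul x) r a.2 b.2) s t (a.1, j) (b.1, l) := by
    funext s; ext i k
    change sliceR (H.comul (convR g x)) s i k t j l = _
    rw [sliceR_comul_convR hg, convR_apply]
    simp only [applyRight, Matrix.of_apply]
    congr 1
    funext r; ext p q
    exact (H.coassoc x s t r i k j l p q).symm
  rw [h, apply_applyRight f hg]
  congr 1
  funext r; ext p q
  change f (sliceL (H.comul (sliceL (H.comul x) r p q)) t j l) =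
    sliceL (H.comul (convL f x)) r p q t j l
  rw [sliceL_comul_convL]
  rfl

end Convolution

end DiscreteQuantumGroup

/-! ### The trace of the regular representation -/

section WeightedTrace

variable {I : Type u} {J : Type v} {d : I → ℕ} {e : J → ℕ}

theorem factorsThroughFinite_of_finite [Finite I] (f : BlockFun d →ₗ[ℂ] ℂ) :
    FactorsThroughFinite f := by
  have := Fintype.ofFinite I
  refine ⟨Finset.univ, fun x hx => ?_⟩
  rw [show x = 0 from funext fun s => hx s (Finset.mem_univ s), map_zero]

variable [Fintype I] [Fintype J]

/-- The trace of the left regular representation of `⨁ₛ M_{d(s)}(ℂ)`. -/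
def regTrace (d : I → ℕ) : BlockFun d →ₗ[ℂ] ℂ where
  toFun x := ∑ s, d s * (x s).trace
  map_add' x y := by simp [mul_add, Finset.sum_add_distrib]
  map_smul' c x := by simp [Finset.mul_sum, mul_left_comm]

theorem regTrace_apply (x : BlockFun d) : regTrace d x = ∑ s, d s * (x s).trace := rfl

theorem regTrace_nonneg {x : BlockFun d} (hx : ∀ s, (x s).PosSemidef) : 0 ≤ regTrace d x :=
  Finset.sum_nonneg fun s _ => mul_nonneg (Nat.cast_nonneg _) (hx s).trace_nonneg

theorem eq_zero_of_regTrace_eq_zero {x : BlockFun d} (hx : ∀ s, (x s).PosSemidef)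
    (h : regTrace d x = 0) : x = 0 := by
  rw [regTrace_apply, Finset.sum_eq_zero_iff_of_nonneg
    fun s _ => mul_nonneg (Nat.cast_nonneg _) (hx s).trace_nonneg] at h
  funext s
  rcases mul_eq_zero.1 (h s (Finset.mem_univ s)) with h0 | h0
  · ext i
    have : d s = 0 := by exact_mod_cast h0
    exact absurd i.2 (by omega)
  · exact (hx s).trace_eq_zero_iff.1 h0

theorem regTrace_one : regTrace d 1 = ∑ s, (d s : ℂ) ^ 2 := by
  simp [regTrace_apply, sq]

/-- Left multiplication by a matrix over `⨁ₛ M_{d(s)}(ℂ)`. -/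
def matMulLeft {n : ℕ} (M : Fin n → Fin n → BlockFun d) :
    (Fin n → BlockFun d) →ₗ[ℂ] (Fin n → BlockFun d) where
  toFun v j := ∑ l, M j l * v l
  map_add' v w := by funext j; simp [mul_add, Finset.sum_add_distrib]
  map_smul' c v := by funext j; simp [Finset.smul_sum]

theorem trace_matMulLeft {n : ℕ} (M : Fin n → Fin n → BlockFun d) :
    LinearMap.trace ℂ _ (matMulLeft M) = ∑ j, regTrace d (M j j) := by
  classical
  rw [LinearMap.trace_eq_matrix_trace ℂ
    (Pi.basis fun _ : Fin n => Pi.basis fun s : I => Matrix.stdBasis ℂ (Fin (d s)) (Fin (d s)))]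
  simp only [Matrix.trace, Matrix.diag_apply, LinearMap.toMatrix_apply, Fintype.sum_sigma,
    Fintype.sum_prod_type, regTrace_apply]
  refine Finset.sum_congr rfl fun j _ => Finset.sum_congr rfl fun s _ => ?_
  rw [Finset.mul_sum]
  refine Finset.sum_congr rfl fun i _ => ?_
  -- Left multiplication acts on each column of a block in the same way, so the diagonal coefficient
  -- does not depend on the column `k`; summing over `k` produces the weight `d s`.
  have h : ∀ k : Fin (d s), ((Pi.basis fun _ : Fin n => Pi.basis fun s : I =>
      Matrix.stdBasis ℂ (Fin (d s)) (Fin (d s))).repr (matMulLeft M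
        ((Pi.basis fun _ : Fin n => Pi.basis fun s : I =>
          Matrix.stdBasis ℂ (Fin (d s)) (Fin (d s))) ⟨j, ⟨s, (i, k)⟩⟩))) ⟨j, ⟨s, (i, k)⟩⟩ =
      M j j s i i := by
    intro k
    rw [Pi.basis_repr, Pi.basis_repr, Pi.basis_apply, Pi.basis_apply, Matrix.stdBasis_eq_single]
    have : (matMulLeft M (Pi.single j (Pi.single s (Matrix.single i k 1)))) j s =
        M j j s * Matrix.single i k 1 := by
      simp only [matMulLeft, LinearMap.coe_mk, AddHom.coe_mk, Finset.sum_apply, Pi.mul_apply]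
      rw [Finset.sum_eq_single j]
      · simp
      · intro l _ hl
        simp [Pi.single_eq_of_ne hl]
      · simp
    rw [this]
    change (M j j s * Matrix.single i k (1 : ℂ)) i k = _
    simp
  rw [Finset.sum_congr rfl fun k _ => h k]
  simp

end WeightedTrace

/-! ### Elementary tensors and faithfulness of the product trace -/

section Tensor

variable {I : Type u} {J : Type v} {d : I → ℕ} {e : J → ℕ}

open scoped Kronecker

/-- `1 ⊗ y`. -/
def oneTensor (d : I → ℕ) (y : BlockFun e) : BlockFun₂ d e := fun _ t => 1 ⊗ₖ y t

/-- `x ⊗ 1`. -/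
def tensorOne (e : J → ℕ) (x : BlockFun d) : BlockFun₂ d e := fun s _ => x s ⊗ₖ 1

theorem star_oneTensor (y : BlockFun e) : star (oneTensor d y) = oneTensor d (star y) := by
  funext s t
  simp [oneTensor, Matrix.star_eq_conjTranspose, Matrix.conjTranspose_kronecker]

theorem star_tensorOne (x : BlockFun d) : star (tensorOne e x) = tensorOne e (star x) := by
  funext s t
  simp [tensorOne, Matrix.star_eq_conjTranspose, Matrix.conjTranspose_kronecker]

theorem oneTensor_mul (y z : BlockFun e) :
    oneTensor d (y * z) = oneTensor d y * oneTensor d z := by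
  funext s t
  simp [oneTensor, ← Matrix.mul_kronecker_mul]

theorem tensorOne_mul (y z : BlockFun d) :
    tensorOne e (y * z) = tensorOne e y * tensorOne e z := by
  funext s t
  simp [tensorOne, ← Matrix.mul_kronecker_mul]

theorem applyLeft_oneTensor_mul (f : BlockFun d →ₗ[ℂ] ℂ) (z : BlockFun e) (y : BlockFun₂ d e) :
    applyLeft f (oneTensor d z * y) = z * applyLeft f y := by
  funext t; ext j l
  have h : sliceL (oneTensor d z * y) t j l = ∑ m, z t j m • sliceL y t m l := by
    funext s; ext i k
    simp [sliceL, oneTensor, Matrix.mul_apply, Fintype.sum_prod_type, Finset.sum_apply,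
      Matrix.sum_apply, Matrix.one_apply]
  simp only [applyLeft, Matrix.of_apply, h, map_sum, map_smul, smul_eq_mul, Pi.mul_apply,
    Matrix.mul_apply]

theorem applyRight_tensorOne_mul (f : BlockFun e →ₗ[ℂ] ℂ) (z : BlockFun d) (y : BlockFun₂ d e) :
    applyRight f (tensorOne e z * y) = z * applyRight f y := by
  funext t; ext j l
  have h : sliceR (tensorOne e z * y) t j l = ∑ m, z t j m • sliceR y t m l := by
    funext s; ext i k
    simp [sliceR, tensorOne, Matrix.mul_apply, Fintype.sum_prod_type, Finset.sum_apply,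
      Matrix.sum_apply, Matrix.one_apply]
  simp only [applyRight, Matrix.of_apply, h, map_sum, map_smul, smul_eq_mul, Pi.mul_apply,
    Matrix.mul_apply]

theorem sliceL_oneTensor (z : BlockFun e) (t : J) (j l : Fin (e t)) :
    sliceL (oneTensor d z) t j l = z t j l • 1 := by
  funext s; ext i k
  simp [sliceL, oneTensor, Matrix.one_apply]

theorem sliceR_oneTensor (z : BlockFun e) (s : I) (i k : Fin (d s)) :
    sliceR (oneTensor d z) s i k = (1 : Matrix (Fin (d s)) (Fin (d s)) ℂ) i k • z := by
  funext s; ext i k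
  simp [sliceR, oneTensor]

theorem sliceR_tensorOne (z : BlockFun d) (s : I) (i k : Fin (d s)) :
    sliceR (tensorOne e z) s i k = z s i k • 1 := by
  funext s; ext i k
  simp [sliceR, tensorOne, Matrix.one_apply]

theorem sliceL_tensorOne (z : BlockFun d) (t : J) (j l : Fin (e t)) :
    sliceL (tensorOne e z) t j l = (1 : Matrix (Fin (e t)) (Fin (e t)) ℂ) j l • z := by
  funext s; ext i k
  simp [sliceL, tensorOne, mul_comm]

theorem applyLeft_oneTensor (f : BlockFun d →ₗ[ℂ] ℂ) (z : BlockFun e) :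
    applyLeft f (oneTensor d z) = f 1 • z := by
  funext t; ext j l
  simp [applyLeft, sliceL_oneTensor, mul_comm]

theorem applyRight_tensorOne (f : BlockFun e →ₗ[ℂ] ℂ) (z : BlockFun d) :
    applyRight f (tensorOne e z) = f 1 • z := by
  funext t; ext j l
  simp [applyRight, sliceR_tensorOne, mul_comm]

variable [Fintype I] [Fintype J]

theorem regTrace_star (x : BlockFun d) : regTrace d (star x) = star (regTrace d x) := by
  simp [regTrace_apply, Matrix.star_eq_conjTranspose, Matrix.trace_conjTranspose]

theorem regTrace_applyLeft_star (y : BlockFun₂ d e) :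
    regTrace e (applyLeft (regTrace d) (star y)) =
      star (regTrace e (applyLeft (regTrace d) y)) := by
  rw [← regTrace_star]
  congr 1
  funext t; ext j l
  change regTrace d (sliceL (star y) t j l) = star (regTrace d (sliceL y t l j))
  rw [← regTrace_star]
  rfl

theorem regTrace_applyLeft_eq_sum (y : BlockFun₂ d e) :
    regTrace e (applyLeft (regTrace d) y) = ∑ t, ∑ s, (e t * d s : ℂ) * (y s t).trace := by
  simp only [regTrace_apply, applyLeft, Matrix.trace, Matrix.diag_apply, Matrix.of_apply, sliceL,
    Fintype.sum_prod_type, Finset.mul_sum]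
  refine Finset.sum_congr rfl fun t _ => ?_
  rw [Finset.sum_comm]
  refine Finset.sum_congr rfl fun s _ => ?_
  rw [Finset.sum_comm]
  simp only [mul_assoc]

theorem eq_zero_of_regTrace_applyLeft_eq_zero (hd : ∀ s, d s ≠ 0) (he : ∀ t, e t ≠ 0)
    {y : BlockFun₂ d e} (h : regTrace e (applyLeft (regTrace d) (star y * y)) = 0) : y = 0 := by
  have hpos : ∀ t s, (0 : ℂ) ≤ ((star y * y) s t).trace := fun t s =>
    (Matrix.posSemidef_conjTranspose_mul_self (y s t)).trace_nonneg
  have hw : ∀ t s, (0 : ℂ) ≤ e t * d s := fun t s =>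
    mul_nonneg (Nat.cast_nonneg _) (Nat.cast_nonneg _)
  rw [regTrace_applyLeft_eq_sum, Finset.sum_eq_zero_iff_of_nonneg fun t _ =>
    Finset.sum_nonneg fun s _ => mul_nonneg (hw t s) (hpos t s)] at h
  funext s t
  have h1 := (Finset.sum_eq_zero_iff_of_nonneg fun s _ => mul_nonneg (hw t s) (hpos t s)).1
    (h t (Finset.mem_univ t)) s (Finset.mem_univ s)
  have h2 : (e t * d s : ℂ) ≠ 0 :=
    mul_ne_zero (Nat.cast_ne_zero.2 (he t)) (Nat.cast_ne_zero.2 (hd s))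
  have h3 := (mul_eq_zero.1 h1).resolve_left h2
  exact Matrix.trace_conjTranspose_mul_self_eq_zero_iff.1 h3

end Tensor

namespace DiscreteQuantumGroup

/-! ### The Haar state of a finite quantum group -/

section Haar

variable {G : DiscreteQuantumGroup.{u}}

theorem sliceL_comul_mul (x y : G.Fun) (t : G.Idx) (j l : Fin (G.dim t)) :
    sliceL (G.comul (x * y)) t j l =
      ∑ m, sliceL (G.comul x) t j m * sliceL (G.comul y) t m l := by
  funext s; ext i k
  rw [map_mul]
  simp only [sliceL, Pi.mul_apply, Matrix.mul_apply, Fintype.sum_prod_type, Finset.sum_apply,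
    Matrix.sum_apply, Matrix.of_apply]
  rw [Finset.sum_comm]

theorem sliceR_comul_mul (x y : G.Fun) (t : G.Idx) (j l : Fin (G.dim t)) :
    sliceR (G.comul (x * y)) t j l =
      ∑ m, sliceR (G.comul x) t j m * sliceR (G.comul y) t m l := by
  funext s; ext i k
  rw [map_mul]
  simp only [sliceR, Pi.mul_apply, Matrix.mul_apply, Fintype.sum_prod_type, Finset.sum_apply,
    Matrix.sum_apply, Matrix.of_apply]

/-- `a ⊗ b ↦ Δ(a)(1 ⊗ b)`, on a column of the second leg. -/
def galoisMap (t : G.Idx) : (Fin (G.dim t) → G.Fun) →ₗ[ℂ] (Fin (G.dim t) → G.Fun) where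
  toFun v j := ∑ l, convR (coordFun t j l) (v l)
  map_add' v w := by funext j; simp [Finset.sum_add_distrib]
  map_smul' c v := by funext j; simp [Finset.smul_sum]

theorem galoisMap_apply (t : G.Idx) (v : Fin (G.dim t) → G.Fun) (j : Fin (G.dim t)) :
    galoisMap t v j = ∑ l, sliceL (G.comul (v l)) t j l := rfl

/-- `a ⊗ b ↦ (ι ⊗ S)Δ(a)(1 ⊗ b)`, on a column of the second leg. -/
def galoisInv (t : G.Idx) : (Fin (G.dim (G.conj t)) → G.Fun) →ₗ[ℂ]
    (Fin (G.dim (G.conj t)) → G.Fun) where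
  toFun v j := ∑ l, ∑ p, ∑ q, G.antipode t (Matrix.single p q 1) j l •
    convR (coordFun t p q) (v l)
  map_add' v w := by funext j; simp [Finset.sum_add_distrib]
  map_smul' c v := by funext j; simp only [Pi.smul_apply, map_smul, Finset.smul_sum,
    RingHom.id_apply, smul_comm c]

/-- In Sweedler notation, `a₁ ⊗ a₂ S(a₃) b = a ⊗ b`: coassociativity reduces the claim to the
antipode axiom applied to the second leg of `Δ(a)`. -/
theorem galoisMap_comp_galoisInv (t : G.Idx) :
    galoisMap (G.conj t) ∘ₗ galoisInv t = LinearMap.id := by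
  refine LinearMap.ext fun v => ?_
  funext j s
  ext i k
  have key : ∀ l, ∑ m, ∑ p, ∑ q, G.antipode t (Matrix.single p q 1) m l *
      G.comul (sliceL (G.comul (v l)) t p q) s (G.conj t) (i, j) (k, m) =
      if j = l then v l s i k else 0 := by
    intro l
    have h := congrFun (congrFun (G.antipode_right (sliceR (G.comul (v l)) s i k) t) j) l
    rw [G.counit_right, Matrix.smul_apply, Matrix.one_apply, smul_eq_mul, mul_ite, mul_one,
      mul_zero] at h
    rw [← h, Matrix.sum_apply]
    rw [Finset.sum_comm]
    refine Finset.sum_congr rfl fun p _ => ?_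
    rw [Finset.sum_comm, Matrix.sum_apply]
    refine Finset.sum_congr rfl fun q _ => ?_
    rw [Matrix.mul_apply]
    refine Finset.sum_congr rfl fun m _ => ?_
    rw [mul_comm, G.coassoc]
    rfl
  have h2 : ∀ m : Fin (G.dim (G.conj t)), ∀ x : G.Fun,
      sliceL (G.comul x) (G.conj t) j m s i k = G.comulEntry s (G.conj t) (i, j) (k, m) x :=
    fun _ _ => rfl
  simp only [LinearMap.comp_apply, galoisMap_apply, LinearMap.id_apply, Finset.sum_apply,
    Matrix.sum_apply, h2]
  simp only [galoisInv, LinearMap.coe_mk, AddHom.coe_mk, map_sum, map_smul, smul_eq_mul]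
  rw [Finset.sum_comm]
  have := fun l => key l
  simp only [comulEntry, LinearMap.coe_mk, AddHom.coe_mk, convR_coordFun]
  simp only [key]
  simp

/-- Multiplicativity of the coproduct: `Δ(x) Δ(a)(1 ⊗ b) = Δ(xa)(1 ⊗ b)`. The Galois map thus
intertwines multiplication by `x ⊗ 1` and by `Δ(x)`. -/
theorem matMulLeft_comp_galoisMap (x : G.Fun) (t : G.Idx) :
    matMulLeft (fun j l => sliceL (G.comul x) t j l) ∘ₗ galoisMap t =
      galoisMap t ∘ₗ matMulLeft fun j l => if j = l then x else 0 := by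
  refine LinearMap.ext fun v => ?_
  funext j
  simp only [LinearMap.comp_apply, matMulLeft, LinearMap.coe_mk, AddHom.coe_mk, galoisMap_apply,
    ite_mul, zero_mul, Finset.sum_ite_eq, Finset.mem_univ, if_true, sliceL_comul_mul,
    Finset.mul_sum]
  rw [Finset.sum_comm]

theorem eq_smul_one_of_comul_eq_oneTensor {y : G.Fun} (hy : G.comul y = oneTensor G.dim y) :
    y = G.counit y • 1 := by
  funext s; ext i k
  rw [← G.counit_right y s i k, hy, sliceR_oneTensor, map_smul]
  simp [mul_comm]

theorem eq_smul_one_of_comul_eq_tensorOne {y : G.Fun} (hy : G.comul y = tensorOne G.dim y) :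
    y = G.counit y • 1 := by
  funext s; ext i k
  rw [← G.counit_left y s i k, hy, sliceL_tensorOne, map_smul]
  simp [mul_comm]

variable [Fintype G.Idx]

/-- Conjugate operators have equal traces: the left side is the trace of multiplication by `Δ(x)`,
the right side that of multiplication by `x ⊗ 1`. -/
theorem sum_regTrace_sliceL (x : G.Fun) (t : G.Idx) :
    ∑ j, regTrace G.dim (sliceL (G.comul x) t j j) = G.dim t * regTrace G.dim x := by
  obtain ⟨t, rfl⟩ := G.conj_involutive.surjective t
  have h1 := galoisMap_comp_galoisInv t
  -- In finite dimension a one-sided inverse is two-sided, so the other antipode axiom is not needed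
  -- here.
  have h2 : galoisInv t ∘ₗ galoisMap (G.conj t) = LinearMap.id :=
    mul_eq_one_comm.1 h1
  rw [← trace_matMulLeft fun j l => sliceL (G.comul x) (G.conj t) j l]
  have h3 : matMulLeft (fun j l => sliceL (G.comul x) (G.conj t) j l) =
      galoisMap (G.conj t) ∘ₗ (matMulLeft fun j l => if j = l then x else 0) ∘ₗ
        galoisInv t := by
    rw [← LinearMap.comp_assoc, ← matMulLeft_comp_galoisMap, LinearMap.comp_assoc, h1,
      LinearMap.comp_id]
  rw [h3, LinearMap.trace_comp_comm', LinearMap.comp_assoc, h2, LinearMap.comp_id,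
    trace_matMulLeft]
  simp

/-- `h * h = h(1)h` for the trace `h` of the regular representation. -/
theorem regTrace_convL (x : G.Fun) :
    regTrace G.dim (convL (regTrace G.dim) x) = regTrace G.dim 1 * regTrace G.dim x := by
  rw [regTrace_apply (convL _ _)]
  have h : ∀ t, (convL (regTrace G.dim) x t).trace = G.dim t * regTrace G.dim x := fun t =>
    sum_regTrace_sliceL x t
  simp only [h, regTrace_one, Finset.sum_mul, sq, mul_assoc]

theorem convL_convL_regTrace (x : G.Fun) :
    convL (regTrace G.dim) (convL (regTrace G.dim) x) =
      regTrace G.dim 1 • convL (regTrace G.dim) x := by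
  rw [convL_convL]
  funext t; ext j l
  rw [convL_apply, LinearMap.comp_apply, regTrace_convL]
  rfl

theorem convR_convR_regTrace (x : G.Fun) :
    convR (regTrace G.dim) (convR (regTrace G.dim) x) =
      regTrace G.dim 1 • convR (regTrace G.dim) x := by
  have hf := factorsThroughFinite_of_finite (regTrace G.dim)
  rw [convR_convR _ hf]
  funext t; ext j l
  rw [convR_apply, LinearMap.comp_apply, apply_convR _ hf, regTrace_convL]
  rfl

/-- Equality in Cauchy–Schwarz. Expanding `(h ⊗ h)(|Δ(y) - 1 ⊗ y|²)` gives four terms, each equal to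
`h(1) h(y*y)`; they cancel, and `h ⊗ h` is faithful. -/
theorem comul_eq_oneTensor {y : G.Fun}
    (hy : convL (regTrace G.dim) y = regTrace G.dim 1 • y) : G.comul y = oneTensor G.dim y := by
  have hd : ∀ s, G.dim s ≠ 0 := fun s => (G.dim_pos s).ne'
  rw [← sub_eq_zero]
  apply eq_zero_of_regTrace_applyLeft_eq_zero hd hd
  set h := regTrace G.dim
  let Φ : BlockFun₂ G.dim G.dim → ℂ := fun z => h (applyLeft h z)
  have hsub : ∀ z w, Φ (z - w) = Φ z - Φ w := fun z w => by
    simp only [Φ, ← map_sub]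
    congr 1
    funext t; ext j l
    exact map_sub h (sliceL z t j l) (sliceL w t j l)
  have h1 : Φ (star (G.comul y) * G.comul y) = h 1 * h (star y * y) := by
    rw [← map_star, ← map_mul]
    exact regTrace_convL _
  have h2 : Φ (star (oneTensor G.dim y) * G.comul y) = h 1 * h (star y * y) := by
    simp only [Φ]
    rw [star_oneTensor, applyLeft_oneTensor_mul]
    change h (star y * convL h y) = _
    rw [hy, mul_smul_comm, map_smul, smul_eq_mul]
  have h3 : Φ (star (oneTensor G.dim y) * oneTensor G.dim y) = h 1 * h (star y * y) := by
    simp only [Φ]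
    rw [star_oneTensor, ← oneTensor_mul, applyLeft_oneTensor, map_smul, smul_eq_mul]
  have h4 : Φ (star (G.comul y) * oneTensor G.dim y) = h 1 * h (star y * y) := by
    have : star (G.comul y) * oneTensor G.dim y =
        star (star (oneTensor G.dim y) * G.comul y) := by
      rw [star_mul, star_star]
    rw [this]
    refine (regTrace_applyLeft_star _).trans ?_
    change star (Φ _) = _
    rw [h2, star_mul', ← regTrace_star, ← regTrace_star, star_mul, star_star, star_one]
  change Φ _ = 0
  rw [star_sub, sub_mul, mul_sub, mul_sub, hsub, hsub, hsub, h1, h2, h3, h4]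
  ring

theorem comul_eq_tensorOne {y : G.Fun}
    (hy : convR (regTrace G.dim) y = regTrace G.dim 1 • y) : G.comul y = tensorOne G.dim y := by
  have hd : ∀ s, G.dim s ≠ 0 := fun s => (G.dim_pos s).ne'
  have hf := factorsThroughFinite_of_finite (regTrace G.dim)
  rw [← sub_eq_zero]
  apply eq_zero_of_regTrace_applyLeft_eq_zero hd hd
  set h := regTrace G.dim
  let Φ : BlockFun₂ G.dim G.dim → ℂ := fun z => h (applyLeft h z)
  have hΦ : ∀ z, Φ z = h (applyRight h z) := fun z => (apply_applyRight h hf z).symm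
  have hsub : ∀ z w, Φ (z - w) = Φ z - Φ w := fun z w => by
    simp only [Φ, ← map_sub]
    congr 1
    funext t; ext j l
    exact map_sub h (sliceL z t j l) (sliceL w t j l)
  have h1 : Φ (star (G.comul y) * G.comul y) = h 1 * h (star y * y) := by
    rw [← map_star, ← map_mul]
    exact regTrace_convL _
  have h2 : Φ (star (tensorOne G.dim y) * G.comul y) = h 1 * h (star y * y) := by
    rw [hΦ, star_tensorOne, applyRight_tensorOne_mul]
    change h (star y * convR h y) = _
    rw [hy, mul_smul_comm, map_smul, smul_eq_mul]
  have h3 : Φ (star (tensorOne G.dim y) * tensorOne G.dim y) = h 1 * h (star y * y) := by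
    rw [hΦ, star_tensorOne, ← tensorOne_mul, applyRight_tensorOne, map_smul, smul_eq_mul]
  have h4 : Φ (star (G.comul y) * tensorOne G.dim y) = h 1 * h (star y * y) := by
    have : star (G.comul y) * tensorOne G.dim y =
        star (star (tensorOne G.dim y) * G.comul y) := by
      rw [star_mul, star_star]
    rw [this]
    refine (regTrace_applyLeft_star _).trans ?_
    change star (Φ _) = _
    rw [h2, star_mul', ← regTrace_star, ← regTrace_star, star_mul, star_star, star_one]
  change Φ _ = 0
  rw [star_sub, sub_mul, mul_sub, mul_sub, hsub, hsub, hsub, h1, h2, h3, h4]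
  ring

theorem regTrace_one_ne_zero : regTrace G.dim 1 ≠ 0 := by
  intro h
  have h1 : (1 : G.Fun) = 0 := eq_zero_of_regTrace_eq_zero (fun s => Matrix.PosSemidef.one) h
  have h2 : G.counit 1 = 0 := by rw [h1, map_zero]
  exact one_ne_zero ((map_one G.counit).symm.trans h2)

end Haar

/-- The Haar state of a finite quantum group. -/
theorem exists_haar (G : DiscreteQuantumGroup.{u}) [Finite G.Idx] :
    ∃ ω : G.Fun →ₗ[ℂ] ℂ, FactorsThroughFinite ω ∧ ω 1 = 1 ∧ (∀ x, IsPositive x → 0 ≤ ω x) ∧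
      (∀ x, IsPositive x → ω x = 0 → x = 0) ∧
      (∀ x, convL ω x = ω x • 1) ∧ ∀ x, convR ω x = ω x • 1 := by
  have := Fintype.ofFinite G.Idx
  set h := regTrace G.dim
  have h0 : h 1 ≠ 0 := regTrace_one_ne_zero
  have hinv : 0 ≤ (h 1)⁻¹ := by
    have : 0 ≤ h 1 := regTrace_nonneg fun s => Matrix.PosSemidef.one
    exact inv_nonneg.2 this
  have hL : ∀ x, convL h x = h x • 1 := fun x => by
    have h1 := eq_smul_one_of_comul_eq_oneTensor (comul_eq_oneTensor (convL_convL_regTrace x))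
    have h2 := regTrace_convL x
    rw [h1, map_smul, smul_eq_mul, mul_comm] at h2
    rw [h1, mul_left_cancel₀ h0 h2]
  have hR : ∀ x, convR h x = h x • 1 := fun x => by
    have h1 := eq_smul_one_of_comul_eq_tensorOne (comul_eq_tensorOne (convR_convR_regTrace x))
    have h2 := regTrace_convL x
    rw [← apply_convR _ (factorsThroughFinite_of_finite (regTrace G.dim)), h1, map_smul,
      smul_eq_mul, mul_comm] at h2
    rw [h1, mul_left_cancel₀ h0 h2]
  refine ⟨(h 1)⁻¹ • h, factorsThroughFinite_of_finite _, inv_mul_cancel₀ h0,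
    fun x hx => mul_nonneg hinv (regTrace_nonneg hx),
    fun x hx hx0 => eq_zero_of_regTrace_eq_zero hx ?_, fun x => ?_, fun x => ?_⟩
  · exact (mul_eq_zero.1 hx0).resolve_left (inv_ne_zero h0)
  · have : convL ((h 1)⁻¹ • h) x = (h 1)⁻¹ • convL h x := rfl
    rw [this, hL, smul_smul]
    rfl
  · have : convR ((h 1)⁻¹ • h) x = (h 1)⁻¹ • convR h x := rfl
    rw [this, hR, smul_smul]
    rfl

/-! ### Convolution of finitely supported functions -/

section FiniteSupport

variable {H : DiscreteQuantumGroup.{u}}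

theorem mem_linf_of_finite_support {x : H.Fun}
    (hx : {s | x s ≠ 0}.Finite) : x ∈ H.linf := by
  open scoped Matrix.Norms.L2Operator in
  refine ⟨∑ s ∈ hx.toFinset, ‖x s‖, fun s => ?_⟩
  by_cases hs : x s = 0
  · rw [hs, norm_zero]
    exact Finset.sum_nonneg fun _ _ => norm_nonneg _
  · exact Finset.single_le_sum (f := fun s => ‖x s‖) (fun _ _ => norm_nonneg _)
      (hx.mem_toFinset.2 hs)

theorem convR_finite_support {g : H.Fun →ₗ[ℂ] ℂ}
    (hg : FactorsThroughFinite g) {x : H.Fun} (hx : {s | x s ≠ 0}.Finite) :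
    {s | convR g x s ≠ 0}.Finite := by
  obtain ⟨T, hT⟩ := hg
  refine (T.finite_toSet.biUnion fun t _ => H.comul_finite_left x hx t).subset fun s hs => ?_
  by_contra h
  simp only [Set.mem_iUnion, Set.mem_ofPred_eq, not_exists, not_not] at h
  refine hs ?_
  ext i k
  refine hT _ fun t ht => ?_
  ext j l
  simp [sliceR, h t ht]

theorem convL_finite_support {f : H.Fun →ₗ[ℂ] ℂ}
    (hf : FactorsThroughFinite f) {x : H.Fun} (hx : {s | x s ≠ 0}.Finite) :
    {s | convL f x s ≠ 0}.Finite := by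
  obtain ⟨T, hT⟩ := hf
  refine (T.finite_toSet.biUnion fun t _ => H.comul_finite_right x hx t).subset fun s hs => ?_
  by_contra h
  simp only [Set.mem_iUnion, Set.mem_ofPred_eq, not_exists, not_not] at h
  refine hs ?_
  ext i k
  refine hT _ fun t ht => ?_
  ext j l
  simp [sliceL, h t ht]

end FiniteSupport

/-! ### Uniqueness of the counit as an idempotent character -/

section Counit

variable {H : DiscreteQuantumGroup.{u}}

/-- The counit as a linear functional. -/
def counitFun (H : DiscreteQuantumGroup.{u}) : H.Fun →ₗ[ℂ] ℂ := H.counit.toAlgHom.toLinearMap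

theorem counitFun_apply (x : H.Fun) : H.counitFun x = H.counit x := rfl

theorem counitFun_finite : FactorsThroughFinite H.counitFun := H.counit_finite

theorem convL_counitFun (x : H.Fun) : convL H.counitFun x = x := by
  funext t; ext j l
  exact H.counit_left x t j l

theorem convR_counitFun (x : H.Fun) : convR H.counitFun x = x := by
  funext t; ext j l
  exact H.counit_right x t j l

/-- The counit is the only character of finite support which is idempotent for the
convolution. -/
theorem eq_counit_of_idempotent (χ : H.Fun →ₐ[ℂ] ℂ) (hχ : FactorsThroughFinite χ)
    (h : ∀ x, χ (convR χ.toLinearMap x) = χ x) (x : H.Fun) : χ x = H.counit x := by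
  classical
  have hχ' : FactorsThroughFinite χ.toLinearMap := hχ
  -- A character living on finitely many blocks is nonzero on exactly one central block projection,
  -- and so factors through that block.
  obtain ⟨c, hc⟩ : ∃ c, χ (Pi.single c 1) ≠ 0 := by
    by_contra! h0
    obtain ⟨T, hT⟩ := hχ'.exists_eq_sum_single
    have h1 : χ 1 = ∑ s ∈ T, χ (Pi.single s 1) := hT 1
    rw [map_one, Finset.sum_eq_zero fun s _ => h0 s] at h1
    exact one_ne_zero h1
  have hc1 : χ (Pi.single c 1) = 1 := by
    have h1 : χ (Pi.single c 1) * χ (Pi.single c 1) = χ (Pi.single c 1) := by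
      rw [← map_mul, ← Pi.single_mul, one_mul]
    exact (mul_eq_left₀ hc).1 h1
  have hsingle : ∀ y : H.Fun, χ (Pi.single c (y c)) = χ y := by
    intro y
    have h1 : (Pi.single c (y c) : H.Fun) = y * Pi.single c 1 := by
      funext s
      by_cases hs : s = c
      · subst hs
        simp
      · simp [Pi.single_eq_of_ne hs]
    rw [h1, map_mul, hc1, mul_one]
  obtain ⟨c, rfl⟩ := H.conj_involutive.surjective c
  -- `η = χ ∘ S` is a convolution inverse of `χ`; an invertible idempotent is the unit `ε`.
  let η : H.Fun → ℂ := fun y => ∑ i, ∑ k,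
    χ (Pi.single (H.conj c) (H.antipode c (Matrix.single i k 1))) * y c i k
  have hη : ∀ y, η (convR χ.toLinearMap y) = H.counit y := by
    intro y
    have h1 := congrArg (fun a => χ (Pi.single (H.conj c) a)) (H.antipode_left y c)
    have h2 : χ (Pi.single (H.conj c) (H.counit y •
        (1 : Matrix (Fin (H.dim (H.conj c))) (Fin (H.dim (H.conj c))) ℂ))) = H.counit y := by
      rw [Pi.single_smul, map_smul, hc1, smul_eq_mul, mul_one]
    rw [h2] at h1
    rw [← h1]
    have h3 : ∀ a : Matrix (Fin (H.dim (H.conj c))) (Fin (H.dim (H.conj c))) ℂ,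
        χ (Pi.single (H.conj c) a) = (χ.toLinearMap ∘ₗ LinearMap.single ℂ _ (H.conj c)) a :=
      fun a => rfl
    rw [h3, map_sum]
    refine Finset.sum_congr rfl fun i _ => ?_
    rw [map_sum]
    refine Finset.sum_congr rfl fun k _ => ?_
    rw [← h3, Pi.single_mul, map_mul, hsingle]
    rfl
  have h4 : H.counit (convR χ.toLinearMap x) = H.counit x := by
    rw [← hη, convR_convR _ hχ', ← hη x]
    exact congrArg η (congrArg (fun f => convR f x) (LinearMap.ext h).symm).symm
  rw [← h4, ← counitFun_apply, apply_convR _ hχ', convL_counitFun]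
  rfl

end Counit

/-! ### Averaging over the subgroup -/

namespace QuantumSubgroup

variable {G : DiscreteQuantumGroup.{v}} {H : DiscreteQuantumGroup.{u}}

/-- The functional `f ∘ π` on the functions on `H`. -/
def pull (N : QuantumSubgroup G H) (f : G.Fun →ₗ[ℂ] ℂ) : H.Fun →ₗ[ℂ] ℂ :=
  f ∘ₗ N.π.toAlgHom.toLinearMap

theorem pull_apply (N : QuantumSubgroup G H) (f : G.Fun →ₗ[ℂ] ℂ) (x : H.Fun) :
    N.pull f x = f (N.π x) := rfl

theorem pull_finite (N : QuantumSubgroup G H) {f : G.Fun →ₗ[ℂ] ℂ} (hf : FactorsThroughFinite f) :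
    FactorsThroughFinite (N.pull f) :=
  hf.comp N.normal

theorem π_convR_coordFun (N : QuantumSubgroup G H) (x : H.Fun) (t : G.Idx) (j l : Fin (G.dim t)) :
    N.π (convR (N.pull (coordFun t j l)) x) = sliceL (G.comul (N.π x)) t j l := by
  funext s; ext i k
  exact (N.map_comul x s t i k j l).symm

theorem π_convL_coordFun (N : QuantumSubgroup G H) (x : H.Fun) (t : G.Idx) (j l : Fin (G.dim t)) :
    N.π (convL (N.pull (coordFun t j l)) x) = sliceR (G.comul (N.π x)) t j l := by
  funext s; ext i k
  change N.pull (coordFun s i k) _ = _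
  rw [← apply_convR _ (N.pull_finite (coordFun_finite s i k)), pull_apply, π_convR_coordFun]
  rfl

theorem π_convR (N : QuantumSubgroup G H) {g : G.Fun →ₗ[ℂ] ℂ} (hg : FactorsThroughFinite g)
    (x : H.Fun) : N.π (convR (N.pull g) x) = convR g (N.π x) := by
  funext s; ext i k
  change N.pull (coordFun s i k) _ = _
  rw [apply_convR _ (N.pull_finite hg), pull_apply, π_convL_coordFun]
  rfl

theorem π_convL (N : QuantumSubgroup G H) (f : G.Fun →ₗ[ℂ] ℂ)
    (x : H.Fun) : N.π (convL (N.pull f) x) = convL f (N.π x) := by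
  funext s; ext i k
  change N.pull (coordFun s i k) _ = _
  rw [← apply_convR _ (N.pull_finite (coordFun_finite s i k)), pull_apply, π_convR_coordFun]
  rfl

/-- Compatibility with the coproducts makes `ε_G ∘ π` a convolution idempotent character, hence the
counit of `H`. This lets faithfulness of the Haar state of `G` control values at the unit of `H`. -/
theorem counit_π (N : QuantumSubgroup G H) (x : H.Fun) : G.counit (N.π x) = H.counit x := by
  refine eq_counit_of_idempotent (G.counit.toAlgHom.comp N.π.toAlgHom)
    (N.pull_finite counitFun_finite) (fun y => ?_) x
  change G.counit (N.π (convR (N.pull G.counitFun) y)) = _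
  rw [N.π_convR counitFun_finite, convR_counitFun]
  rfl

section Invariance

variable (N : QuantumSubgroup G H) {ω : G.Fun →ₗ[ℂ] ℂ} (hω : FactorsThroughFinite ω)
  (h1 : ω 1 = 1)

include h1 in
theorem isLeftInvariant_iff (hL : ∀ x, convL ω x = ω x • 1) (x : H.Fun) :
    N.IsLeftInvariant x ↔ convL (N.pull ω) x = x := by
  refine ⟨fun h => ?_, fun h t j l => ?_⟩
  · funext t; ext j l
    rw [convL_apply, pull_apply, h t j l, map_smul, h1, smul_eq_mul, mul_one]
  · conv_lhs => rw [← h]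
    rw [sliceL_comul_convL, N.π_convL, hL]
    conv_rhs => rw [← h]
    rfl

include h1 hω in
theorem isRightInvariant_iff (hR : ∀ x, convR ω x = ω x • 1) (x : H.Fun) :
    N.IsRightInvariant x ↔ convR (N.pull ω) x = x := by
  refine ⟨fun h => ?_, fun h t j l => ?_⟩
  · funext t; ext j l
    rw [convR_apply, pull_apply, h t j l, map_smul, h1, smul_eq_mul, mul_one]
  · conv_lhs => rw [← h]
    rw [sliceR_comul_convR (N.pull_finite hω), N.π_convR hω, hR]
    conv_rhs => rw [← h]
    rfl

include h1 in
theorem convL_pull_idem (hL : ∀ x, convL ω x = ω x • 1) (x : H.Fun) :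
    convL (N.pull ω) (convL (N.pull ω) x) = convL (N.pull ω) x := by
  rw [convL_convL]
  refine congrArg (fun f => convL f x) (LinearMap.ext fun y => ?_)
  change ω (N.π _) = ω _
  rw [N.π_convL, hL, map_smul, h1, smul_eq_mul, mul_one]
  rfl

include h1 hω in
theorem convR_pull_idem (hR : ∀ x, convR ω x = ω x • 1) (x : H.Fun) :
    convR (N.pull ω) (convR (N.pull ω) x) = convR (N.pull ω) x := by
  rw [convR_convR _ (N.pull_finite hω)]
  refine congrArg (fun f => convR f x) (LinearMap.ext fun y => ?_)
  change ω (N.π _) = ω _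
  rw [N.π_convR hω, hR, map_smul, h1, smul_eq_mul, mul_one]
  rfl

include h1 hω in
/-- The left and right averages over a finite normal subgroup coincide. -/
theorem convL_pull_eq_convR_pull (hN : N.IsNormal) (hL : ∀ x, convL ω x = ω x • 1)
    (hR : ∀ x, convR ω x = ω x • 1) (x : H.Fun) :
    convL (N.pull ω) x = convR (N.pull ω) x := by
  have hθ := N.pull_finite hω
  -- Normality concerns bounded functions only, so it is used on finitely supported `y`, whose
  -- averages are finitely supported. There each average is fixed by the other, and the two commute.
  -- Locality of both sides then gives all functions.
  have key : ∀ y : H.Fun, {s | y s ≠ 0}.Finite →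
      convL (N.pull ω) y = convR (N.pull ω) y := by
    intro y hy
    have hr : convL (N.pull ω) (convR (N.pull ω) y) = convR (N.pull ω) y := by
      rw [← N.isLeftInvariant_iff h1 hL,
        hN _ (mem_linf_of_finite_support (convR_finite_support hθ hy)),
        N.isRightInvariant_iff hω h1 hR, N.convR_pull_idem hω h1 hR]
    have hl : convR (N.pull ω) (convL (N.pull ω) y) = convL (N.pull ω) y := by
      rw [← N.isRightInvariant_iff hω h1 hR,
        ← hN _ (mem_linf_of_finite_support (convL_finite_support hθ hy)),
        N.isLeftInvariant_iff h1 hL, N.convL_pull_idem h1 hL]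
    rw [← hl, ← convL_convR_comm _ hθ, hr]
  funext t; ext j l
  exact FactorsThroughFinite.eq_of_finite_support
    (f := coordFun t j l ∘ₗ convL (N.pull ω)) (g := coordFun t j l ∘ₗ convR (N.pull ω))
    ((coordFun_finite t j l).comp (convL_finite hθ))
    ((coordFun_finite t j l).comp (convR_finite hθ))
    (fun y hy => congrFun (congrFun (congrFun (key y hy) t) j) l) x

end Invariance

end QuantumSubgroup

/-! ### Positive functions and vector functionals -/

section Positivity

variable {H : DiscreteQuantumGroup.{u}}

theorem posSemidef_of_forall_nonneg {n : Type*} [Fintype n] {A : Matrix n n ℂ}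
    (h : ∀ w : n → ℂ, 0 ≤ star w ⬝ᵥ A.mulVec w) : A.PosSemidef := by
  classical
  rw [← Matrix.isPositive_toEuclideanLin_iff, LinearMap.isPositive_iff_complex]
  intro x
  have h1 := h x.ofLp
  have h2 : inner ℂ (A.toEuclideanLin x) x = star (star x.ofLp ⬝ᵥ A.mulVec x.ofLp) := by
    rw [EuclideanSpace.inner_eq_star_dotProduct, Matrix.star_dotProduct, star_star]
    exact dotProduct_comm _ _
  have h3 : star (star x.ofLp ⬝ᵥ A.mulVec x.ofLp) = star x.ofLp ⬝ᵥ A.mulVec x.ofLp :=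
    (IsSelfAdjoint.of_nonneg h1)
  rw [h2, h3]
  refine ⟨?_, ?_⟩
  · apply Complex.ext
    · simp
    · simpa using (Complex.nonneg_iff.1 h1).2
  · exact (Complex.nonneg_iff.1 h1).1

/-- The functional `x ↦ ⟨xₜ w, w⟩`. -/
def vecFun (t : H.Idx) (w : Fin (H.dim t) → ℂ) : H.Fun →ₗ[ℂ] ℂ :=
  ∑ j, ∑ l, (star (w j) * w l) • coordFun t j l

theorem vecFun_eq_sum (t : H.Idx) (w : Fin (H.dim t) → ℂ) (x : H.Fun) :
    vecFun t w x = ∑ j, ∑ l, star (w j) * w l * x t j l := by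
  simp only [vecFun, LinearMap.sum_apply, LinearMap.smul_apply, smul_eq_mul, coordFun_apply]

theorem vecFun_apply (t : H.Idx) (w : Fin (H.dim t) → ℂ) (x : H.Fun) :
    vecFun t w x = star w ⬝ᵥ (x t).mulVec w := by
  simp only [vecFun_eq_sum, dotProduct, Matrix.mulVec, Finset.mul_sum, Pi.star_apply]
  refine Finset.sum_congr rfl fun j _ => Finset.sum_congr rfl fun l _ => ?_
  ring

theorem vecFun_finite (t : H.Idx) (w : Fin (H.dim t) → ℂ) : FactorsThroughFinite (vecFun t w) :=
  ⟨{t}, fun x hx => by simp [vecFun_apply, hx t]⟩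

theorem isPositive_iff {x : H.Fun} : IsPositive x ↔ ∀ t w, 0 ≤ vecFun t w x := by
  refine ⟨fun h t w => ?_, fun h t => posSemidef_of_forall_nonneg fun w => ?_⟩
  · rw [vecFun_apply]
    exact (h t).dotProduct_mulVec_nonneg w
  · rw [← vecFun_apply]
    exact h t w

theorem isPositive_star_mul_self (x : H.Fun) : IsPositive (star x * x) := fun s =>
  Matrix.posSemidef_conjTranspose_mul_self (x s)

theorem IsPositive.exists_eq_star_mul_self {x : H.Fun} (hx : IsPositive x) :
    ∃ y : H.Fun, x = star y * y := by
  open scoped Matrix.Norms.L2Operator MatrixOrder in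
  choose y hy using fun s => CStarAlgebra.nonneg_iff_eq_star_mul_self.1 (hx s).nonneg
  exact ⟨y, funext hy⟩

theorem IsPositive.map {G : DiscreteQuantumGroup.{v}} {x : H.Fun} (hx : IsPositive x)
    (f : H.Fun →⋆ₐ[ℂ] G.Fun) : IsPositive (f x) := by
  obtain ⟨y, rfl⟩ := hx.exists_eq_star_mul_self
  rw [map_mul, map_star]
  exact isPositive_star_mul_self _

theorem IsPositive.counit_nonneg {x : H.Fun} (hx : IsPositive x) : 0 ≤ H.counit x := by
  obtain ⟨y, rfl⟩ := hx.exists_eq_star_mul_self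
  rw [map_mul, map_star]
  exact star_mul_self_nonneg _

theorem IsPositive.comul {x : H.Fun} (hx : IsPositive x) (s t : H.Idx) :
    (H.comul x s t).PosSemidef := by
  obtain ⟨y, rfl⟩ := hx.exists_eq_star_mul_self
  rw [map_mul, map_star]
  exact Matrix.posSemidef_conjTranspose_mul_self (H.comul y s t)

theorem IsPositive.convR_vecFun {x : H.Fun} (hx : IsPositive x) (t : H.Idx)
    (w : Fin (H.dim t) → ℂ) : IsPositive (convR (vecFun t w) x) := by
  intro s
  -- `M` is the operator `v ↦ v ⊗ w`, so the slice is a compression of `Δ(x)_{s,t}`.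
  let M : Matrix (Fin (H.dim s) × Fin (H.dim t)) (Fin (H.dim s)) ℂ :=
    Matrix.of fun p k => if p.1 = k then w p.2 else 0
  have h : convR (vecFun t w) x s = M.conjTranspose * H.comul x s t * M := by
    ext i k
    rw [convR_apply, vecFun_eq_sum, Matrix.mul_apply, Fintype.sum_prod_type]
    simp only [Matrix.mul_apply, Fintype.sum_prod_type, M, Matrix.conjTranspose_apply,
      Matrix.of_apply, sliceR]
    rw [Finset.sum_eq_single k, Finset.sum_comm]
    · refine Finset.sum_congr rfl fun l _ => ?_
      rw [Finset.sum_eq_single i, if_pos rfl, Finset.sum_mul]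
      · refine Finset.sum_congr rfl fun j _ => ?_
        simp only [if_true]
        ring
      · intro b _ hb
        simp [hb]
      · simp
    · intro b _ hb
      simp [hb]
    · simp
  rw [h]
  exact (hx.comul s t).conjTranspose_mul_mul_same M

theorem IsPositive.smul {x : H.Fun} (hx : IsPositive x) {c : ℝ} (hc : 0 ≤ c) :
    IsPositive ((c : ℂ) • x) := by
  rw [isPositive_iff] at hx ⊢
  intro t w
  rw [map_smul, smul_eq_mul]
  exact mul_nonneg (Complex.zero_le_real.2 hc) (hx t w)

theorem isPositive_one : IsPositive (1 : H.Fun) := fun _ => Matrix.PosSemidef.one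

/-- The bounded functions as a subspace. -/
def linfSubmodule (H : DiscreteQuantumGroup.{u}) : Submodule ℂ H.Fun where
  carrier := H.linf
  zero_mem' := mem_linf_of_finite_support (by simp)
  add_mem' := by
    open scoped Matrix.Norms.L2Operator in
    rintro x y ⟨C, hC⟩ ⟨D, hD⟩
    exact ⟨C + D, fun s => (norm_add_le (x s) (y s)).trans (add_le_add (hC s) (hD s))⟩
  smul_mem' := by
    open scoped Matrix.Norms.L2Operator in
    rintro c x ⟨C, hC⟩
    exact ⟨‖c‖ * C, fun s => (norm_smul c (x s)).trans_le
      (mul_le_mul_of_nonneg_left (hC s) (norm_nonneg c))⟩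

theorem star_mem_linf {x : H.Fun} (hx : x ∈ H.linf) : star x ∈ H.linf := by
  open scoped Matrix.Norms.L2Operator in
  obtain ⟨C, hC⟩ := hx
  exact ⟨C, fun s => (norm_star (x s)).le.trans (hC s)⟩

theorem one_mem_linf : (1 : H.Fun) ∈ H.linf := by
  open scoped Matrix.Norms.L2Operator in
  refine ⟨1, fun s => ?_⟩
  have : Nonempty (Fin (H.dim s)) := ⟨⟨0, H.dim_pos s⟩⟩
  exact (CStarRing.norm_one (E := Matrix (Fin (H.dim s)) (Fin (H.dim s)) ℂ)).le

/-- A bounded self-adjoint function is bounded above and below by constants. -/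
theorem exists_isPositive_smul_one_sub {x : H.Fun} (hx : x ∈ H.linf) (hs : star x = x) :
    ∃ C : ℝ, 0 ≤ C ∧ IsPositive ((C : ℂ) • 1 - x) ∧ IsPositive ((C : ℂ) • 1 + x) := by
  open scoped Matrix.Norms.L2Operator MatrixOrder in
  obtain ⟨C, hC⟩ := hx
  have hsa : ∀ s, IsSelfAdjoint (x s) := fun s => congrFun hs s
  have hD : ∀ s, ‖x s‖ ≤ max C 0 := fun s => (hC s).trans (le_max_left _ _)
  have h1 : ∀ s, x s ≤ algebraMap ℝ _ (max C 0) := fun s =>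
    (hsa s).le_algebraMap_norm_self.trans (algebraMap_mono _ (hD s))
  have h2 : ∀ s, -algebraMap ℝ _ (max C 0) ≤ x s := fun s =>
    (neg_le_neg (algebraMap_mono _ (hD s))).trans (hsa s).neg_algebraMap_norm_le_self
  have h3 : ∀ s, algebraMap ℝ (Matrix (Fin (H.dim s)) (Fin (H.dim s)) ℂ) (max C 0) =
      ((max C 0 : ℝ) : ℂ) • 1 := fun s => by
    rw [Algebra.algebraMap_eq_smul_one, Complex.coe_smul]
  refine ⟨max C 0, le_max_right _ _, fun s => ?_, fun s => ?_⟩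
  · have h := Matrix.le_iff.1 (h1 s)
    rwa [h3] at h
  · have h := Matrix.le_iff.1 (h2 s)
    rwa [h3, sub_neg_eq_add, add_comm] at h

/-- Adding large constants makes the real and imaginary parts positive without leaving `W`. Positive
and negative parts would not do, as the harmonic functions are not closed under functional calculus.
-/
theorem exists_isPositive_decomposition {W : Submodule ℂ H.Fun} (h1 : 1 ∈ W)
    (hstar : ∀ x ∈ W, star x ∈ W) (hW : ∀ x ∈ W, x ∈ H.linf) {x : H.Fun} (hx : x ∈ W) :
    ∃ (p q : H.Fun) (c : ℂ), p ∈ W ∧ q ∈ W ∧ IsPositive p ∧ IsPositive q ∧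
      x = p + Complex.I • q + c • 1 := by
  have key : ∀ a ∈ W, star a = a → ∃ (p : H.Fun) (C : ℂ), p ∈ W ∧ IsPositive p ∧
      a = p - C • 1 := by
    intro a ha hs
    obtain ⟨C, -, -, hC⟩ := exists_isPositive_smul_one_sub (hW a ha) hs
    exact ⟨_, C, W.add_mem (W.smul_mem _ h1) ha, hC, by abel⟩
  obtain ⟨p, C, hpW, hp, hC⟩ := key ((1 / 2 : ℂ) • (x + star x))
    (W.smul_mem _ (W.add_mem hx (hstar x hx))) (by
      rw [star_smul, star_add, star_star, add_comm]; simp)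
  obtain ⟨q, D, hqW, hq, hD⟩ := key ((-Complex.I / 2 : ℂ) • (x - star x))
    (W.smul_mem _ (W.sub_mem hx (hstar x hx))) (by
      rw [star_smul, star_sub, star_star, ← neg_sub x, smul_neg, ← neg_smul]
      congr 1
      simp [neg_div])
  refine ⟨p, q, -(C + Complex.I * D), hpW, hqW, hp, hq, ?_⟩
  have h2 : x = (1 / 2 : ℂ) • (x + star x) +
      Complex.I • ((-Complex.I / 2 : ℂ) • (x - star x)) := by
    rw [smul_smul, show Complex.I * (-Complex.I / 2) = 1 / 2 by
      rw [← mul_div_assoc, mul_neg, Complex.I_mul_I, neg_neg], ← smul_add]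
    rw [show x + star x + (x - star x) = (2 : ℂ) • x by rw [two_smul]; abel, smul_smul]
    norm_num
  rw [hC, hD] at h2
  rw [h2]
  module

end Positivity

/-! ### The Markov operator and convolution powers of the state -/

section Harmonic

variable {H : DiscreteQuantumGroup.{u}} (φ : H.NormalState)

namespace NormalState

/-- `P_φ(x) = y` for possibly unbounded functions. -/
def MapsTo (x y : H.Fun) : Prop :=
  ∀ (t : H.Idx) (j l : Fin (H.dim t)),
    HasSum (fun s => φ.block s (sliceL (H.comul x) t j l s)) (y t j l)

variable {φ}

theorem MapsTo.hasSum_apply {x y : H.Fun} (h : φ.MapsTo x y) {f : H.Fun →ₗ[ℂ] ℂ}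
    (hf : FactorsThroughFinite f) : HasSum (fun s => φ.block s (convR f x s)) (f y) := by
  obtain ⟨T, c, hc⟩ := hf.exists_eq_sum
  have h1 : ∀ s, φ.block s (convR f x s) =
      ∑ t ∈ T, ∑ j, ∑ l, c t j l * φ.block s (sliceL (H.comul x) t j l s) := by
    intro s
    have : convR f x s = ∑ t ∈ T, ∑ j, ∑ l, c t j l • sliceL (H.comul x) t j l s := by
      ext i k
      rw [convR_apply, hc]
      simp only [Matrix.sum_apply, Matrix.smul_apply, smul_eq_mul]
      rfl
    simp only [this, map_sum, map_smul, smul_eq_mul]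
  simp only [h1, hc]
  exact hasSum_sum fun t _ => hasSum_sum fun j _ => hasSum_sum fun l _ => (h t j l).mul_left _

/-- `P_φ` commutes with right convolution by local functionals. Right translates of harmonic
functions are therefore harmonic, unbounded ones included. -/
theorem MapsTo.convR {x y : H.Fun} (h : φ.MapsTo x y) {g : H.Fun →ₗ[ℂ] ℂ}
    (hg : FactorsThroughFinite g) : φ.MapsTo (convR g x) (convR g y) := by
  intro t j l
  have := h.hasSum_apply (f := coordFun t j l ∘ₗ DiscreteQuantumGroup.convR g)
    ((coordFun_finite t j l).comp (convR_finite hg))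
  rwa [← convR_convR _ hg] at this

/-- Evaluation at the unit: `φ(x) = ε(P_φ(x))`, so a harmonic function has `φ`-mean `ε(x)`. -/
theorem MapsTo.hasSum_counit {x y : H.Fun} (h : φ.MapsTo x y) :
    HasSum (fun s => φ.block s (x s)) (H.counit y) := by
  have := h.hasSum_apply counitFun_finite
  rwa [convR_counitFun] at this

theorem MapsTo.add {x y x' y' : H.Fun} (h : φ.MapsTo x y) (h' : φ.MapsTo x' y') :
    φ.MapsTo (x + x') (y + y') := by
  intro t j l
  have e : ∀ s, φ.block s (sliceL (H.comul (x + x')) t j l s) =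
      φ.block s (sliceL (H.comul x) t j l s) + φ.block s (sliceL (H.comul x') t j l s) := by
    intro s
    rw [← map_add (φ.block s), map_add H.comul]
    rfl
  simp only [e]
  exact (h t j l).add (h' t j l)

theorem MapsTo.smul {x y : H.Fun} (h : φ.MapsTo x y) (c : ℂ) :
    φ.MapsTo (c • x) (c • y) := by
  intro t j l
  have e : ∀ s, φ.block s (sliceL (H.comul (c • x)) t j l s) =
      c * φ.block s (sliceL (H.comul x) t j l s) := by
    intro s
    rw [← smul_eq_mul, ← map_smul (φ.block s), map_smul H.comul]
    rfl
  simp only [e]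
  exact (h t j l).mul_left c

theorem MapsTo.sub {x y x' y' : H.Fun} (h : φ.MapsTo x y) (h' : φ.MapsTo x' y') :
    φ.MapsTo (x - x') (y - y') := by
  have := h.add (h'.smul (-1))
  rwa [neg_one_smul, neg_one_smul, ← sub_eq_add_neg, ← sub_eq_add_neg] at this

theorem comul_one_eq : H.comul 1 = oneTensor H.dim 1 := by
  rw [map_one]
  funext s t
  simp [oneTensor]

variable (φ)

theorem mapsTo_one : φ.MapsTo 1 1 := by
  intro t j l
  have h : ∀ s, φ.block s (sliceL (H.comul 1) t j l s) = (1 : H.Fun) t j l * φ.block s 1 := by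
    intro s
    rw [comul_one_eq, sliceL_oneTensor, Pi.smul_apply, map_smul, smul_eq_mul]
    rfl
  simp only [h]
  simpa using φ.hasSum_one.mul_left ((1 : H.Fun) t j l)

theorem block_mono {s : H.Idx} {a b : Matrix (Fin (H.dim s)) (Fin (H.dim s)) ℂ}
    (h : (b - a).PosSemidef) : φ.block s a ≤ φ.block s b := by
  have := φ.nonneg s _ h
  rwa [map_sub, sub_nonneg] at this

theorem summable_of_le {x z : H.Fun} (hx : IsPositive x) (hxz : IsPositive (z - x))
    (hz : Summable fun s => φ.block s (z s)) : Summable fun s => φ.block s (x s) := by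
  refine Summable.of_norm_bounded hz.norm fun s => ?_
  have h0 := φ.nonneg s _ (hx s)
  have h1 := φ.block_mono (hxz s)
  exact CStarAlgebra.norm_le_norm_of_nonneg_of_le h0 h1

theorem summable_of_mem_linf {x : H.Fun} (hx : x ∈ H.linf) :
    Summable fun s => φ.block s (x s) := by
  obtain ⟨p, q, c, hp, hq, hp0, hq0, rfl⟩ := exists_isPositive_decomposition
    (W := H.linfSubmodule) one_mem_linf (fun _ => star_mem_linf) (fun _ h => h) hx
  have hc : ∀ c : ℂ, Summable fun s => φ.block s ((c • (1 : H.Fun)) s) := fun c =>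
    (φ.mapsTo_one.smul c).hasSum_counit.summable
  have key : ∀ p ∈ H.linf, IsPositive p → Summable fun s => φ.block s (p s) := by
    intro p hp hp0
    obtain ⟨C, -, hC, -⟩ := exists_isPositive_smul_one_sub hp (funext fun s => (hp0 s).1)
    exact φ.summable_of_le hp0 hC (hc C)
  have e : ∀ s, φ.block s ((p + Complex.I • q + c • 1 : H.Fun) s) =
      φ.block s (p s) + Complex.I • φ.block s (q s) + φ.block s ((c • 1 : H.Fun) s) := by
    intro s
    rw [← map_smul, ← map_add, ← map_add]
    rfl
  simp only [e]
  exact ((key p hp hp0).add ((key q hq hq0).const_smul _)).add (hc c)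

end NormalState

/-- The functions which are constant outside a finite set of blocks. -/
def eventuallyConst (H : DiscreteQuantumGroup.{u}) : Submodule ℂ H.Fun where
  carrier := {x | ∃ c : ℂ, {s | (x - c • 1) s ≠ 0}.Finite}
  zero_mem' := ⟨0, by simp⟩
  add_mem' := by
    rintro x y ⟨c, hc⟩ ⟨e, he⟩
    refine ⟨c + e, (hc.union he).subset fun s hs => ?_⟩
    by_contra h
    simp only [Set.mem_union, Set.mem_ofPred_eq, not_or, not_not] at h
    refine hs ?_
    have : x + y - (c + e) • (1 : H.Fun) = (x - c • 1) + (y - e • 1) := by module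
    rw [this, Pi.add_apply, h.1, h.2, add_zero]
  smul_mem' := by
    rintro a x ⟨c, hc⟩
    refine ⟨a * c, hc.subset fun s hs h => hs ?_⟩
    have : a • x - (a * c) • (1 : H.Fun) = a • (x - c • 1) := by module
    rw [this, Pi.smul_apply, h, smul_zero]

theorem one_mem_eventuallyConst : (1 : H.Fun) ∈ H.eventuallyConst := ⟨1, by simp⟩

theorem mem_eventuallyConst_of_finite_support {x : H.Fun} (hx : {s | x s ≠ 0}.Finite) :
    x ∈ H.eventuallyConst := ⟨0, by simpa using hx⟩

theorem exists_eq_of_mem_eventuallyConst {x : H.Fun} (hx : x ∈ H.eventuallyConst) :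
    ∃ (c : ℂ) (y : H.Fun), {s | y s ≠ 0}.Finite ∧ x = c • 1 + y := by
  obtain ⟨c, hc⟩ := hx
  exact ⟨c, _, hc, by abel⟩

theorem mem_linf_of_mem_eventuallyConst {x : H.Fun} (hx : x ∈ H.eventuallyConst) :
    x ∈ H.linf := by
  obtain ⟨c, y, hy, rfl⟩ := exists_eq_of_mem_eventuallyConst hx
  exact H.linfSubmodule.add_mem (H.linfSubmodule.smul_mem c one_mem_linf)
    (mem_linf_of_finite_support hy)

theorem star_mem_eventuallyConst {x : H.Fun} (hx : x ∈ H.eventuallyConst) :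
    star x ∈ H.eventuallyConst := by
  obtain ⟨c, hc⟩ := hx
  refine ⟨star c, hc.subset fun s hs h => hs ?_⟩
  have : star x - star c • (1 : H.Fun) = star (x - c • 1) := by simp
  rw [this, Pi.star_apply, h, star_zero]

theorem convR_one (g : H.Fun →ₗ[ℂ] ℂ) : convR g (1 : H.Fun) = g 1 • 1 := by
  have h : H.comul 1 = tensorOne H.dim 1 := by
    rw [map_one]
    funext s t
    simp [tensorOne]
  funext s; ext i k
  rw [convR_apply, h, sliceR_tensorOne, map_smul]
  simp [mul_comm]

theorem convR_mem_eventuallyConst {g : H.Fun →ₗ[ℂ] ℂ} (hg : FactorsThroughFinite g) {x : H.Fun}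
    (hx : x ∈ H.eventuallyConst) : convR g x ∈ H.eventuallyConst := by
  obtain ⟨c, y, hy, rfl⟩ := exists_eq_of_mem_eventuallyConst hx
  rw [map_add, map_smul, convR_one]
  exact add_mem (H.eventuallyConst.smul_mem _ (H.eventuallyConst.smul_mem _
    one_mem_eventuallyConst)) (mem_eventuallyConst_of_finite_support (convR_finite_support hg hy))

/-- On eventually constant functions the convolution powers are positive linear functionals,
and they are dominated by the counit on elements which lie below a harmonic one. -/
theorem NormalState.exists_convPow_eq (n : ℕ) :
    ∃ F : H.Fun →ₗ[ℂ] ℂ, (∀ x ∈ H.eventuallyConst, φ.convPow n x = F x) ∧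
      (∀ x ∈ H.eventuallyConst, IsPositive x → 0 ≤ F x) ∧
      ∀ x ∈ H.eventuallyConst, IsPositive x → ∀ z, φ.MapsTo z z → IsPositive (z - x) →
        F x ≤ H.counit z := by
  induction n with
  | zero =>
    refine ⟨H.counitFun, fun x _ => rfl, fun x _ hx => hx.counit_nonneg, fun x _ _ z _ hz => ?_⟩
    have := hz.counit_nonneg
    rwa [map_sub, sub_nonneg] at this
  | succ n ih =>
    obtain ⟨F, hF, hpos, hle⟩ := ih
    have hvec : ∀ t w x, vecFun t w (convL F x) = F (convR (vecFun t w) x) := fun t w x =>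
      (apply_convR F (vecFun_finite t w) x).symm
    have hupos : ∀ x ∈ H.eventuallyConst, IsPositive x → IsPositive (convL F x) := by
      intro x hx hx0
      rw [isPositive_iff]
      intro t w
      rw [hvec]
      exact hpos _ (convR_mem_eventuallyConst (vecFun_finite t w) hx) (hx0.convR_vecFun t w)
    -- The induction hypothesis is applied to the right translates of `x` and `z` by vector
    -- functionals. The counit of such a translate of `z` is a matrix coefficient of `z`, so scalar
    -- bounds become an operator inequality.
    have hule : ∀ x ∈ H.eventuallyConst, IsPositive x → ∀ z, φ.MapsTo z z →
        IsPositive (z - x) → IsPositive (z - convL F x) := by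
      intro x hx hx0 z hz hxz
      rw [isPositive_iff]
      intro t w
      have h1 := hle _ (convR_mem_eventuallyConst (vecFun_finite t w) hx) (hx0.convR_vecFun t w)
        _ (hz.convR (vecFun_finite t w)) (by
          rw [← map_sub]
          exact hxz.convR_vecFun t w)
      rw [← hvec, ← counitFun_apply, apply_convR _ (vecFun_finite t w), convL_counitFun] at h1
      rwa [map_sub, sub_nonneg]
    have hsumpos : ∀ x ∈ H.eventuallyConst, IsPositive x →
        Summable fun s => φ.block s (convL F x s) := by
      intro x hx hx0
      obtain ⟨C, hC0, hC, -⟩ := exists_isPositive_smul_one_sub (mem_linf_of_mem_eventuallyConst hx)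
        (funext fun s => (hx0 s).1)
      have hz := φ.mapsTo_one.smul C
      exact φ.summable_of_le (hupos x hx hx0) (hule x hx hx0 _ hz hC) hz.hasSum_counit.summable
    have hsum : ∀ x ∈ H.eventuallyConst, Summable fun s => φ.block s (convL F x s) := by
      intro x hx
      obtain ⟨p, q, c, hp, hq, hp0, hq0, rfl⟩ := exists_isPositive_decomposition
        one_mem_eventuallyConst (fun _ => star_mem_eventuallyConst)
        (fun _ => mem_linf_of_mem_eventuallyConst) hx
      simp only [map_add, map_smul, Pi.add_apply, Pi.smul_apply]
      exact ((hsumpos p hp hp0).add ((hsumpos q hq hq0).const_smul _)).add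
        ((hsumpos 1 one_mem_eventuallyConst isPositive_one).const_smul _)
    let Q : H.eventuallyConst →ₗ[ℂ] ℂ :=
      { toFun := fun x => ∑' s, φ.block s (convL F x s)
        map_add' := fun x y => by
          simp only [Submodule.coe_add, map_add, Pi.add_apply]
          exact (hsum x x.2).tsum_add (hsum y y.2)
        map_smul' := fun c x => by
          simp only [Submodule.coe_smul, map_smul, Pi.smul_apply]
          exact (hsum x x.2).tsum_const_smul c }
    -- The extension is arbitrary; only its values on eventually constant functions are used.
    obtain ⟨F', hF'⟩ := LinearMap.exists_extend Q
    have hF'' : ∀ x ∈ H.eventuallyConst, F' x = ∑' s, φ.block s (convL F x s) := fun x hx =>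
      LinearMap.congr_fun hF' ⟨x, hx⟩
    refine ⟨F', fun x hx => ?_, fun x hx hx0 => ?_, fun x hx hx0 z hz hxz => ?_⟩
    · rw [hF'' x hx]
      have h1 : applyLeft (φ.convPow n) (H.comul x) = convL F x := by
        funext t; ext j l
        exact hF _ (convR_mem_eventuallyConst (coordFun_finite t j l) hx)
      rw [NormalState.convPow, h1]
      rfl
    · rw [hF'' x hx]
      exact tsum_nonneg fun s => φ.nonneg s _ (hupos x hx hx0 s)
    · rw [hF'' x hx]
      exact hasSum_le (fun s => φ.block_mono (hule x hx hx0 z hz hxz s)) (hsum x hx).hasSum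
        hz.hasSum_counit

end Harmonic

end DiscreteQuantumGroup

/-! ### Domination by finitely many functionals -/

/-- A family of positive functionals on a matrix algebra without common kernel contains a finite
family which dominates a given functional. -/
theorem Matrix.exists_le_sum {n : Type*} [Fintype n] {ι : Type*} (τ : Matrix n n ℂ →ₗ[ℂ] ℂ)
    (hτ : ∀ a, a.PosSemidef → 0 ≤ τ a)
    (f : ι → Matrix n n ℂ →ₗ[ℂ] ℂ) (hpos : ∀ i a, a.PosSemidef → 0 ≤ f i a)
    (hne : ∀ w : n → ℂ, w ≠ 0 → ∃ i, f i (Matrix.vecMulVec w (star w)) ≠ 0) :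
    ∃ (T : Finset ι) (C : ℝ), 0 ≤ C ∧ ∀ a, a.PosSemidef → τ a ≤ C * ∑ i ∈ T, f i a := by
  classical
  let g : ι → (n → ℂ) → ℝ := fun i w => (f i (Matrix.vecMulVec w (star w))).re
  have hpsd : ∀ w : n → ℂ, (Matrix.vecMulVec w (star w)).PosSemidef :=
    Matrix.posSemidef_vecMulVec_self_star
  have hg0 : ∀ i w, 0 ≤ g i w := fun i w => (Complex.nonneg_iff.1 (hpos i _ (hpsd w))).1
  have hgc : ∀ i w, ((g i w : ℝ) : ℂ) = f i (Matrix.vecMulVec w (star w)) := fun i w =>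
    Complex.ext rfl (Complex.nonneg_iff.1 (hpos i _ (hpsd w))).2
  have hcont' : ∀ f : Matrix n n ℂ →ₗ[ℂ] ℂ,
      Continuous fun w : n → ℂ => (f (Matrix.vecMulVec w (star w))).re := fun f =>
    Complex.continuous_re.comp (f.continuous_of_finiteDimensional.comp
      (Continuous.matrix_vecMulVec continuous_id continuous_star))
  have hcont : ∀ i, Continuous (g i) := fun i => hcont' (f i)
  obtain ⟨K, hK⟩ := (isCompact_sphere (0 : n → ℂ) 1).exists_bound_of_continuousOn
    (hcont' τ).continuousOn
  have hK' : ∀ w : n → ℂ, ‖w‖ = 1 → (τ (Matrix.vecMulVec w (star w))).re ≤ |K| := fun w hw =>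
    (le_abs_self _).trans ((hK w (by simpa using hw)).trans (le_abs_self K))
  -- Finitely many of the functionals already have a strictly positive sum on the compact unit
  -- sphere. If `m > 0` bounds that sum below and `|K|` bounds `τ` above, then `|K| / m` works on
  -- rank one matrices, and positive matrices are sums of those.
  obtain ⟨T, hT⟩ := (isCompact_sphere (0 : n → ℂ) 1).elim_finite_subcover
    (fun i => {w | 0 < g i w}) (fun i => isOpen_lt continuous_const (hcont i)) (by
      intro w hw
      have hw0 : w ≠ 0 := by
        rintro rfl
        simp at hw
      obtain ⟨i, hi⟩ := hne w hw0
      refine Set.mem_iUnion.2 ⟨i, lt_of_le_of_ne (hg0 i w) fun h => hi ?_⟩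
      rw [← hgc, ← h, Complex.ofReal_zero])
  obtain ⟨m, hm, hmle⟩ := (isCompact_sphere (0 : n → ℂ) 1).exists_forall_le'
    (f := fun w => ∑ i ∈ T, g i w) (a := 0)
    (continuous_finsetSum _ fun i _ => hcont i).continuousOn (by
      intro w hw
      obtain ⟨i, hi⟩ := Set.mem_iUnion.1 (hT hw)
      obtain ⟨hiT, hi⟩ := Set.mem_iUnion.1 hi
      exact Finset.sum_pos' (fun i _ => hg0 i w) ⟨i, hiT, hi⟩)
  have hscale : ∀ (c : ℝ) (w : n → ℂ), Matrix.vecMulVec ((c : ℂ) • w) (star ((c : ℂ) • w)) =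
      ((c ^ 2 : ℝ) : ℂ) • Matrix.vecMulVec w (star w) := by
    intro c w
    ext i j
    simp [Matrix.vecMulVec_apply]
    ring
  have hrank : ∀ w : n → ℂ, (τ (Matrix.vecMulVec w (star w))).re ≤
      (|K| / m) * ∑ i ∈ T, g i w := by
    intro w
    rcases eq_or_ne w 0 with rfl | hw
    · simp [g]
    obtain ⟨c, w, hw1, rfl⟩ : ∃ (c : ℝ) (w' : n → ℂ), ‖w'‖ = 1 ∧ w = (c : ℂ) • w' := by
      refine ⟨‖w‖, ((‖w‖⁻¹ : ℝ) : ℂ) • w, ?_, ?_⟩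
      · rw [norm_smul, Complex.norm_real, norm_inv, norm_norm,
          inv_mul_cancel₀ (norm_ne_zero_iff.2 hw)]
      · rw [smul_smul, ← Complex.ofReal_mul, mul_inv_cancel₀ (norm_ne_zero_iff.2 hw),
          Complex.ofReal_one, one_smul]
    have h1 : ∀ i, g i ((c : ℂ) • w) = c ^ 2 * g i w := by
      intro i
      simp only [g]
      rw [hscale, map_smul, smul_eq_mul, Complex.re_ofReal_mul]
    have h2 := hK' w hw1
    have h3 := hmle w (by simpa using hw1)
    simp only [h1, ← Finset.mul_sum]
    rw [hscale, map_smul, smul_eq_mul, Complex.re_ofReal_mul, mul_left_comm]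
    refine mul_le_mul_of_nonneg_left (h2.trans ?_) (sq_nonneg c)
    rw [div_mul_eq_mul_div, le_div_iff₀ hm]
    exact mul_le_mul_of_nonneg_left h3 (abs_nonneg K)
  refine ⟨T, |K| / m, by positivity, fun a ha => ?_⟩
  obtain ⟨y, hy⟩ : ∃ y : Matrix n n ℂ, a = star y * y := by
    open scoped Matrix.Norms.L2Operator MatrixOrder in
    exact CStarAlgebra.nonneg_iff_eq_star_mul_self.1 ha.nonneg
  have hsum : a = ∑ i, Matrix.vecMulVec (star (y i)) (star (star (y i))) := by
    rw [hy]
    ext k l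
    simp [Matrix.mul_apply, Matrix.sum_apply, Matrix.vecMulVec_apply, Matrix.star_apply]
  have hterm : ∀ w : n → ℂ, τ (Matrix.vecMulVec w (star w)) ≤
      ((|K| / m : ℝ) : ℂ) * ∑ i ∈ T, f i (Matrix.vecMulVec w (star w)) := by
    intro w
    have h1 : τ (Matrix.vecMulVec w (star w)) =
        (((τ (Matrix.vecMulVec w (star w))).re : ℝ) : ℂ) :=
      Complex.ext rfl (Complex.nonneg_iff.1 (hτ _ (hpsd w))).2.symm
    rw [h1]
    simp only [← hgc]
    rw [← Complex.ofReal_sum, ← Complex.ofReal_mul]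
    exact Complex.real_le_real.2 (hrank w)
  rw [hsum, map_sum]
  refine (Finset.sum_le_sum fun i _ => hterm (star (y i))).trans (le_of_eq ?_)
  rw [← Finset.mul_sum, Finset.sum_comm]
  simp only [map_sum]

namespace DiscreteQuantumGroup

/-! ### Harnack's inequality -/

section Harnack

variable {H : DiscreteQuantumGroup.{u}} {φ : H.NormalState}

theorem NormalState.convPow_one (n : ℕ) : φ.convPow n 1 = 1 := by
  induction n with
  | zero => exact map_one H.counit
  | succ n ih =>
    obtain ⟨F, hF, -, -⟩ := NormalState.exists_convPow_eq φ n
    have h : applyLeft (φ.convPow n) (H.comul 1) = 1 := by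
      funext t; ext j l
      change φ.convPow n (sliceL (H.comul 1) t j l) = _
      rw [NormalState.comul_one_eq, sliceL_oneTensor,
        hF _ (H.eventuallyConst.smul_mem _ one_mem_eventuallyConst), map_smul,
        ← hF _ one_mem_eventuallyConst, ih, smul_eq_mul, mul_one]
    rw [NormalState.convPow, h]
    exact φ.hasSum_one.tsum_eq

/-- For a generating state no finitely supported projection is in the kernel of all the
convolution powers. -/
theorem NormalState.IsGenerating.exists_convPow_ne_zero (hφ : φ.IsGenerating) {q : H.Fun}
    (hq : IsStarProjection q) (hfin : {s | q s ≠ 0}.Finite) (h0 : q ≠ 0) :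
    ∃ n, φ.convPow (n + 1) q ≠ 0 := by
  by_contra! h
  -- If every power kills `q`, then `1 - q` has mass one for each of them and so dominates all
  -- supports, which forces `1 - q = 1`.
  refine h0 (sub_eq_self.1 (hφ (1 - q) hq.one_sub fun n hn p hp => hp.2.2 _ hq.one_sub ?_))
  obtain ⟨n, rfl⟩ := Nat.exists_eq_add_of_le' hn
  obtain ⟨F, hF, -, -⟩ := NormalState.exists_convPow_eq φ (n + 1)
  have hq' := mem_eventuallyConst_of_finite_support hfin
  rw [hF _ (H.eventuallyConst.sub_mem one_mem_eventuallyConst hq'), map_sub, ← hF _ hq', h n,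
    ← hF _ one_mem_eventuallyConst, convPow_one, sub_zero]

theorem single_finite_support [DecidableEq H.Idx] (s : H.Idx)
    (a : Matrix (Fin (H.dim s)) (Fin (H.dim s)) ℂ) :
    {t | (Pi.single s a : H.Fun) t ≠ 0}.Finite :=
  (Set.finite_singleton s).subset fun t ht => by
    by_contra h
    exact ht (Pi.single_eq_of_ne (fun h' => h h') _)

theorem isPositive_single [DecidableEq H.Idx] (s : H.Idx)
    {a : Matrix (Fin (H.dim s)) (Fin (H.dim s)) ℂ} (ha : a.PosSemidef) :
    IsPositive (Pi.single s a : H.Fun) := by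
  intro t
  by_cases h : t = s
  · subst h
    simpa using ha
  · rw [Pi.single_eq_of_ne h]
    exact Matrix.PosSemidef.zero

/-- Harnack's inequality: the blocks of a positive harmonic function are controlled by its value
at the unit. -/
theorem NormalState.IsGenerating.exists_block_le (hφ : φ.IsGenerating) (s : H.Idx)
    (τ : Matrix (Fin (H.dim s)) (Fin (H.dim s)) ℂ →ₗ[ℂ] ℂ) (hτ : ∀ a, a.PosSemidef → 0 ≤ τ a) :
    ∃ C : ℝ, 0 ≤ C ∧ ∀ z, IsPositive z → φ.MapsTo z z → τ (z s) ≤ C * H.counit z := by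
  classical
  choose F hF hpos hle using fun n => NormalState.exists_convPow_eq φ (n + 1)
  have hmem : ∀ a, (Pi.single s a : H.Fun) ∈ H.eventuallyConst := fun a =>
    mem_eventuallyConst_of_finite_support (single_finite_support s a)
  obtain ⟨T, C, hC, hT⟩ := Matrix.exists_le_sum τ hτ
    (fun n => F n ∘ₗ LinearMap.single ℂ (fun s => Matrix (Fin (H.dim s)) (Fin (H.dim s)) ℂ) s)
    (fun n a ha => hpos n _ (hmem a) (isPositive_single s ha)) (by
      intro w hw
      let c : ℂ := star w ⬝ᵥ w
      have hc : c ≠ 0 := fun h => hw (dotProduct_star_self_eq_zero.1 h)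
      have hcs : star c = c := by
        simp only [c]
        rw [← Matrix.star_dotProduct_star, star_star]
      -- The rank one projection onto the line of `w`, placed in block `s`.
      have hq : IsStarProjection (Pi.single s (c⁻¹ • Matrix.vecMulVec w (star w)) : H.Fun) := by
        refine ⟨?_, ?_⟩
        · rw [IsIdempotentElem, ← Pi.single_mul]
          congr 1
          rw [smul_mul_smul_comm, Matrix.vecMulVec_mul_vecMulVec, Matrix.vecMulVec_smul, smul_smul]
          congr 1
          change c⁻¹ * c⁻¹ * c = c⁻¹
          field_simp
        · rw [IsSelfAdjoint, ← Pi.single_star, star_smul, star_inv₀, hcs,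
            Matrix.star_eq_conjTranspose, Matrix.conjTranspose_vecMulVec, star_star]
      obtain ⟨n, hn⟩ := hφ.exists_convPow_ne_zero hq (single_finite_support s _) (by
        intro h
        have h1 : c⁻¹ • Matrix.vecMulVec w (star w) = 0 := by
          simpa using congrFun h s
        have h2 := congrArg Matrix.trace h1
        rw [Matrix.trace_smul, Matrix.trace_vecMulVec, Matrix.trace_zero] at h2
        exact (mul_ne_zero (inv_ne_zero hc) (by rw [dotProduct_comm]; exact hc)) h2)
      refine ⟨n, fun h => hn ?_⟩
      rw [hF _ _ (hmem _), Pi.single_smul, map_smul]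
      exact (congrArg _ h).trans (smul_zero _))
  -- Block `s` of `z`, extended by zero, lies below `z`. Each of the `T.card` powers is therefore at
  -- most `ε(z)` on it.
  refine ⟨C * T.card, by positivity, fun z hz hharm => (hT _ (hz s)).trans ?_⟩
  rw [Complex.ofReal_mul, mul_assoc]
  refine mul_le_mul_of_nonneg_left ?_ (Complex.zero_le_real.2 hC)
  refine (Finset.sum_le_card_nsmul T _ (H.counit z) fun n _ => ?_).trans (by simp)
  refine hle n _ (hmem _) (isPositive_single s (hz s)) z hharm fun t => ?_
  by_cases h : t = s
  · subst h
    simpa using Matrix.PosSemidef.zero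
  · rw [Pi.sub_apply, Pi.single_eq_of_ne h, sub_zero]
    exact hz t

/-- Harnack's inequality for a positive functional depending on finitely many blocks. -/
theorem NormalState.IsGenerating.exists_apply_le (hφ : φ.IsGenerating) {f : H.Fun →ₗ[ℂ] ℂ}
    (hf : FactorsThroughFinite f) (hpos : ∀ x, IsPositive x → 0 ≤ f x) :
    ∃ C : ℝ, 0 ≤ C ∧ ∀ z, IsPositive z → φ.MapsTo z z → f z ≤ C * H.counit z := by
  classical
  choose C hC0 hC using fun s => hφ.exists_block_le s
    (f ∘ₗ LinearMap.single ℂ (fun s => Matrix (Fin (H.dim s)) (Fin (H.dim s)) ℂ) s)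
    (fun a ha => hpos _ (isPositive_single s ha))
  obtain ⟨T, hT⟩ := hf.exists_eq_sum_single
  refine ⟨∑ s ∈ T, C s, Finset.sum_nonneg fun s _ => hC0 s, fun z hz hharm => ?_⟩
  rw [hT, Complex.ofReal_sum, Finset.sum_mul]
  exact Finset.sum_le_sum fun s _ => hC s z hz hharm

end Harnack

/-! ### Positive harmonic functions are fixed by the average -/

section Invariant

variable {H : DiscreteQuantumGroup.{u}} {φ : H.NormalState}

theorem IsPositive.eq_zero_of_vecFun_eq_zero {x : H.Fun} (hx : IsPositive x)
    (h : ∀ t w, vecFun t w x = 0) : x = 0 := by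
  have hneg : IsPositive (-x) := isPositive_iff.2 fun t w => by rw [map_neg, h, neg_zero]
  funext s
  refine (hx s).trace_eq_zero_iff.1 (le_antisymm ?_ (hx s).trace_nonneg)
  have := (hneg s).trace_nonneg
  rwa [Pi.neg_apply, Matrix.trace_neg, neg_nonneg] at this

/-- An averaging operator which commutes with `P_φ` and is faithful on positive functions fixes
all positive harmonic functions, if `φ` is generating. -/
theorem NormalState.IsGenerating.convL_eq_self (hφ : φ.IsGenerating) {θ : H.Fun →ₗ[ℂ] ℂ}
    (hθ : FactorsThroughFinite θ) (hpos : ∀ x, IsPositive x → 0 ≤ θ x)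
    (hfaith : ∀ x, IsPositive x → θ x = 0 → H.counit x = 0)
    (hidem : ∀ x, convL θ (convL θ x) = convL θ x) (hcomm : ∀ x, convL θ x = convR θ x)
    {x : H.Fun} (hx : IsPositive x) (hharm : φ.MapsTo x x) : convL θ x = x := by
  have hvec : ∀ t w z, vecFun t w (convL θ z) = θ (convR (vecFun t w) z) := fun t w z =>
    (apply_convR θ (vecFun_finite t w) z).symm
  have hcounit : ∀ t w z, H.counit (convR (vecFun t w) z) = vecFun t w z := fun t w z => by
    rw [← counitFun_apply, apply_convR _ (vecFun_finite t w), convL_counitFun]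
  have hE : ∀ z, φ.MapsTo z z → φ.MapsTo (convL θ z) (convL θ z) := fun z hz => by
    rw [hcomm]
    exact hz.convR hθ
  obtain ⟨C, hC, hle⟩ : ∃ C : ℝ, 1 ≤ C ∧ ∀ z, IsPositive z → φ.MapsTo z z →
      IsPositive ((C : ℂ) • z - convL θ z) := by
    obtain ⟨C, hC0, hC⟩ := hφ.exists_apply_le hθ hpos
    -- The Harnack constant is enlarged to be at least `1`, so that `0 ≤ 1 - C⁻¹ < 1` and its powers
    -- tend to zero.
    refine ⟨C + 1, by linarith, fun z hz hharm => isPositive_iff.2 fun t w => ?_⟩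
    have h1 := hC _ (hz.convR_vecFun t w) (hharm.convR (vecFun_finite t w))
    rw [← hvec, hcounit] at h1
    rw [map_sub, map_smul, smul_eq_mul, sub_nonneg, Complex.ofReal_add, add_mul]
    refine h1.trans (le_add_of_nonneg_right ?_)
    rw [Complex.ofReal_one, one_mul]
    exact isPositive_iff.1 hz t w
  have hC0 : (0 : ℝ) < C := lt_of_lt_of_le one_pos hC
  have hCne : (C : ℂ) ≠ 0 := Complex.ofReal_ne_zero.2 hC0.ne'
  set y := convL θ x
  -- With `z = x - a • y` one has `E z = (1 - a) • y`, so `z ≥ C⁻¹ • E z` replaces `1 - a` by `(1 -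
  -- C⁻¹)(1 - a)`.
  have hstep : ∀ n : ℕ, IsPositive (x - ((1 - (1 - C⁻¹) ^ n : ℝ) : ℂ) • y) := by
    intro n
    induction n with
    | zero => simpa using hx
    | succ n ih =>
      have h1 := (hle _ ih (hharm.sub ((hE x hharm).smul _))).smul (inv_nonneg.2 hC0.le)
      convert h1 using 1
      have h2 : convL θ (x - ((1 - (1 - C⁻¹) ^ n : ℝ) : ℂ) • y) =
          (((1 - C⁻¹) ^ n : ℝ) : ℂ) • y := by
        rw [map_sub, map_smul, hidem]
        push_cast
        module
      rw [h2, smul_sub, smul_smul, smul_smul, Complex.ofReal_inv, inv_mul_cancel₀ hCne, one_smul]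
      push_cast
      rw [pow_succ]
      module
  have hlim : Tendsto (fun n : ℕ => (((1 - (1 - C⁻¹) ^ n : ℝ) : ℂ))) atTop (𝓝 1) := by
    have h1 : Tendsto (fun n : ℕ => 1 - (1 - C⁻¹) ^ n) atTop (𝓝 (1 - 0)) :=
      tendsto_const_nhds.sub (tendsto_pow_atTop_nhds_zero_of_lt_one
        (sub_nonneg.2 (inv_le_one_of_one_le₀ hC)) (sub_lt_self _ (inv_pos.2 hC0)))
    rw [sub_zero] at h1
    have := (Complex.continuous_ofReal.tendsto 1).comp h1
    rwa [Complex.ofReal_one] at this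
  have hxy : IsPositive (x - y) := by
    refine isPositive_iff.2 fun t w => ?_
    have h1 : Tendsto (fun n : ℕ => vecFun t w x -
        ((1 - (1 - C⁻¹) ^ n : ℝ) : ℂ) * vecFun t w y) atTop
        (𝓝 (vecFun t w x - 1 * vecFun t w y)) :=
      tendsto_const_nhds.sub (hlim.mul_const _)
    rw [map_sub]
    rw [one_mul] at h1
    refine ge_of_tendsto' h1 fun n => ?_
    have := isPositive_iff.1 (hstep n) t w
    rwa [map_sub, map_smul, smul_eq_mul] at this
  have hzero : convL θ (x - y) = 0 := by
    rw [map_sub, hidem, sub_self]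
  -- Each vector functional of `x - y` is the counit of a positive right translate, on which `θ`
  -- vanishes because the average of `x - y` is zero.
  refine (sub_eq_zero.1 (hxy.eq_zero_of_vecFun_eq_zero fun t w => ?_)).symm
  rw [← hcounit]
  refine hfaith _ (hxy.convR_vecFun t w) ?_
  rw [← hvec, hzero, map_zero]

end Invariant

/-! ### Bounded harmonic functions and Poisson products -/

section Poisson

variable {H : DiscreteQuantumGroup.{u}} {φ : H.NormalState}

theorem NormalState.block_star (φ : H.NormalState) (s : H.Idx)
    (a : Matrix (Fin (H.dim s)) (Fin (H.dim s)) ℂ) :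
    φ.block s (star a) = star (φ.block s a) := by
  open scoped Matrix.Norms.L2Operator MatrixOrder in
  exact map_star (PositiveLinearMap.mk₀ (φ.block s) fun a ha =>
    φ.nonneg s a (Matrix.nonneg_iff_posSemidef.1 ha)) a

theorem NormalState.MapsTo.star {x y : H.Fun} (h : φ.MapsTo x y) :
    φ.MapsTo (star x) (star y) := by
  intro t j l
  have e : ∀ s, φ.block s (sliceL (H.comul (Star.star x)) t j l s) =
      Star.star (φ.block s (sliceL (H.comul x) t l j s)) := by
    intro s
    rw [← φ.block_star, map_star]
    rfl
  simp only [e]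
  exact (h t l j).star

/-- If a convolution operator fixes all positive harmonic functions, it fixes all bounded ones. -/
theorem convL_eq_self_of_bounded {θ : H.Fun →ₗ[ℂ] ℂ}
    (hpos : ∀ x, IsPositive x → φ.MapsTo x x → convL θ x = x) {x : H.Fun}
    (hx : x ∈ H.linf) (hharm : φ.MapsTo x x) : convL θ x = x := by
  let W : Submodule ℂ H.Fun :=
    { carrier := {x | x ∈ H.linf ∧ φ.MapsTo x x}
      zero_mem' := ⟨H.linfSubmodule.zero_mem, by simpa using φ.mapsTo_one.smul 0⟩
      add_mem' := fun hx hy => ⟨H.linfSubmodule.add_mem hx.1 hy.1, hx.2.add hy.2⟩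
      smul_mem' := fun c x hx => ⟨H.linfSubmodule.smul_mem c hx.1, hx.2.smul c⟩ }
  obtain ⟨p, q, c, hp, hq, hp0, hq0, rfl⟩ := exists_isPositive_decomposition (W := W)
    ⟨one_mem_linf, φ.mapsTo_one⟩ (fun x hx => ⟨star_mem_linf hx.1, hx.2.star⟩)
    (fun x hx => hx.1) ⟨hx, hharm⟩
  rw [map_add, map_add, map_smul, map_smul, hpos p hp0 hp.2, hpos q hq0 hq.2,
    hpos 1 isPositive_one φ.mapsTo_one]

/-- On bounded functions the defining series converges, so its total sum is a genuine sum. The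
convolutions of `H` and `H/G` then differ only in where the slices must lie. -/
theorem isConvolution_restrict_iff {A : Set H.Fun} (hA : A ⊆ H.linf) {x y : H.Fun} :
    IsConvolution A (φ.restrict A) x y ↔
      (∀ t j l, sliceL (H.comul x) t j l ∈ A) ∧ φ.MapsTo x y := by
  refine ⟨fun h => ⟨fun t j l => (h t j l).1, fun t j l => ?_⟩, fun h t j l => ⟨h.1 t j l, ?_⟩⟩
  · obtain ⟨hm, he⟩ := h t j l
    rw [← he]
    exact (φ.summable_of_mem_linf (hA hm)).hasSum
  · exact (h.2 t j l).tsum_eq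

theorem NormalState.MapsTo.unique {x y y' : H.Fun} (h : φ.MapsTo x y) (h' : φ.MapsTo x y') :
    y = y' := by
  funext t; ext j l
  exact (h t j l).unique (h' t j l)

theorem QuantumSubgroup.IsRightInvariant.mul {G : DiscreteQuantumGroup.{v}}
    {N : QuantumSubgroup G H} {x y : H.Fun} (hx : N.IsRightInvariant x)
    (hy : N.IsRightInvariant y) : N.IsRightInvariant (x * y) := by
  intro s i k
  rw [sliceR_comul_mul, map_sum]
  simp only [map_mul, hx s, hy s]
  rw [Pi.mul_apply, Matrix.mul_apply, Finset.sum_smul]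
  refine Finset.sum_congr rfl fun m _ => ?_
  rw [smul_mul_smul_comm, one_mul]

end Poisson

end DiscreteQuantumGroup

/-! ### The main theorem -/

open DiscreteQuantumGroup in
theorem mainTheorem1 (H : DiscreteQuantumGroup.{u}) (G : DiscreteQuantumGroup.{v})
    [Finite G.Idx] (N : DiscreteQuantumGroup.QuantumSubgroup G H) (hN : N.IsNormal)
    (φ : H.NormalState) (hφ : φ.IsGenerating) :
    (∀ x : H.Fun, DiscreteQuantumGroup.IsPositive x → φ.IsHarmonic x →
      N.IsLeftInvariant x ∧ N.IsRightInvariant x) ∧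
    DiscreteQuantumGroup.poissonBoundary H.linf (φ.restrict H.linf) =
      DiscreteQuantumGroup.poissonBoundary N.quotientLinf (φ.restrict N.quotientLinf) ∧
    ∀ x ∈ DiscreteQuantumGroup.poissonBoundary H.linf (φ.restrict H.linf),
      ∀ y ∈ DiscreteQuantumGroup.poissonBoundary H.linf (φ.restrict H.linf),
      ∀ z : H.Fun,
        DiscreteQuantumGroup.IsPoissonProduct H.linf (φ.restrict H.linf) x y z ↔
          DiscreteQuantumGroup.IsPoissonProduct N.quotientLinf
            (φ.restrict N.quotientLinf) x y z := by
  obtain ⟨ω, hω, h1, hpos, hfaith, hL, hR⟩ := exists_haar G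
  have hθ := N.pull_finite hω
  have hleft := N.isLeftInvariant_iff h1 hL
  have hright := N.isRightInvariant_iff hω h1 hR
  have hLR := N.convL_pull_eq_convR_pull hω h1 hN hL hR
  have hmain : ∀ x, IsPositive x → φ.MapsTo x x → convL (N.pull ω) x = x := fun x hx hh =>
    hφ.convL_eq_self hθ (fun x hx => hpos _ (hx.map N.π))
      (fun x hx h => by rw [← N.counit_π, hfaith _ (hx.map N.π) h, map_zero])
      (N.convL_pull_idem h1 hL) hLR hx hh
  have hbdd : ∀ x ∈ H.linf, φ.MapsTo x x → N.IsRightInvariant x := fun x hx hh => by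
    rw [hright, ← hLR]
    exact convL_eq_self_of_bounded hmain hx hh
  -- Left slices are right convolutions by coordinates. By normality invariance may be tested with
  -- the left average, which commutes with them.
  have hslice : ∀ x, N.IsRightInvariant x → ∀ t j l,
      N.IsRightInvariant (sliceL (H.comul x) t j l) := by
    intro x hx t j l
    rw [hright, ← hLR] at hx ⊢
    rw [← convR_coordFun, convL_convR_comm _ (coordFun_finite t j l), hx]
  have hQ : N.quotientLinf ⊆ H.linf := fun x hx => hx.1
  have hconv : ∀ x y, N.IsRightInvariant x → IsConvolution H.linf (φ.restrict H.linf) x y →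
      IsConvolution N.quotientLinf (φ.restrict N.quotientLinf) x y := by
    intro x y hx h
    rw [isConvolution_restrict_iff subset_rfl] at h
    rw [isConvolution_restrict_iff hQ]
    exact ⟨fun t j l => ⟨h.1 t j l, hslice x hx t j l⟩, h.2⟩
  have hconv' : ∀ x y, IsConvolution N.quotientLinf (φ.restrict N.quotientLinf) x y →
      IsConvolution H.linf (φ.restrict H.linf) x y := by
    intro x y h
    rw [isConvolution_restrict_iff hQ] at h
    rw [isConvolution_restrict_iff subset_rfl]
    exact ⟨fun t j l => (h.1 t j l).1, h.2⟩
  have hinv : ∀ x ∈ poissonBoundary H.linf (φ.restrict H.linf), N.IsRightInvariant x :=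
    fun x hx => hbdd x hx.1 ((isConvolution_restrict_iff subset_rfl).1 hx.2).2
  refine ⟨fun x hx hh => ?_, Set.Subset.antisymm (fun x hx => ?_) (fun x hx => ?_),
    fun x hx y hy z => ⟨?_, ?_⟩⟩
  · rw [hleft, hright, ← hLR]
    exact ⟨hmain x hx hh, hmain x hx hh⟩
  · exact ⟨⟨hx.1, hinv x hx⟩, hconv x x (hinv x hx) hx.2⟩
  · exact ⟨hx.1.1, hconv' x x hx.2⟩
  · rintro ⟨w, hw0, hwA, hw, hlim⟩
    -- Multiplicativity of the coproduct gives the start; afterwards `P_φ` commutes with the right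
    -- average, and its values are unique.
    have hwinv : ∀ n, N.IsRightInvariant (w n) := by
      intro n
      induction n with
      | zero =>
        rw [hw0]
        exact (hinv x hx).mul (hinv y hy)
      | succ n ih =>
        have h2 := ((isConvolution_restrict_iff subset_rfl).1 (hw n)).2
        rw [hright] at ih ⊢
        have h3 := h2.convR hθ
        rw [ih] at h3
        exact h3.unique h2
    exact ⟨w, hw0, fun n => ⟨hwA n, hwinv n⟩, fun n => hconv _ _ (hwinv n) (hw n), hlim⟩
  · rintro ⟨w, hw0, hwA, hw, hlim⟩
    exact ⟨w, hw0, fun n => (hwA n).1, fun n => hconv' _ _ (hw n), hlim⟩
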